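/- Let $G=(V,E)$ be a finite simple graph with $V\neq\emptyset$, independence number $\alpha(G)$, and a fixed ordering of $V$; identify vertex sets with bit strings of length $|V|$. Let $\mathcal N_{\rm IS}(G)$ be the tensor network with a two-valued label $s_v$ for every vertex $v$, a vertex tensor $W^{(v)}=(\mathbb 1, x_v)$ for every $v\in V$, an edge tensor $B^{(u,v)}=\begin{pmatrix}\mathbb 1&\mathbb 1\\ \mathbb 1&\mathbb 0\end{pmatrix}$ for every $\{u,v\}\in E$, and scalar output $\sum_{s}\prod_v W^{(v)}_{s_v}\prod_{\{u,v\}\in E}B^{(u,v)}_{s_us_v}$. A contraction order $T$ is a binary tree whose leaves are the input tensors, each exactly once. The network is contracted along $T$, and at each node (a leaf included) all labels that do not occur in a tensor outside the subtree are summed over, one label after the other. Let $\mathrm{ops}(T)$ be the number of additions and multiplications of tensor elements: if the operands at an inner node carry a set $U$ of labels in total and the labels $S\subseteq U$ remain, the node contributes $2^{|U|}$ multiplications and $2^{|U|}-2^{|S|}$ additions; a leaf with label set $U$ contributes $2^{|U|}-2^{|S|}$ additions. The contraction complexity is $cc(\mathcal N_{\rm IS}(G))=\min_T \mathrm{ops}(T)$.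 A sum-product expression tree is built from nodes $\mathtt{LEAF}(\sigma)$ (a bit string), $\mathtt{ZERO}$, $\mathtt{SUM}(l,r)$ and $\mathtt{PROD}(l,r)$, representing respectively $\{\sigma\}$, $\emptyset$, the union, and the elementwise bitwise or. Operands are shared, and a $\mathtt{SUM}$ or $\mathtt{PROD}$ node stores its size, which is the sum or the product of the sizes of its operands ($\mathtt{LEAF}$ has size $1$, $\mathtt{ZERO}$ has size $0$); creating such a node, size included, is one tree operation. As tensor elements, expression trees have $\oplus=\mathtt{SUM}$, $\odot=\mathtt{PROD}$, $\mathbb 0=\mathtt{ZERO}$, $\mathbb 1=\mathtt{LEAF}(0\cdots0)$; moreover, for $K\ge1$ one uses polynomials with expression trees as coefficients, of which only the coefficients of the $K$ largest orders are kept (sums of several coefficients are formed as balanced trees). A sample is drawn from a tree by recursive descent from the root: at a $\mathtt{SUM}$ node the descent continues in one operand, chosen with probability proportional to its size, at the cost of the bit lengths of the two sizes and of their sum plus one; at a $\mathtt{PROD}$ node it continues in both operands and the results are combined by bitwise or, at cost $|V|+1$; a leaf node costs $|V|+1$. There is an absolute constant $C$ such that the following holds for all $G$ as above and every contraction order $T$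 of $\mathcal N_{\rm IS}(G)$; in particular for an optimal one, which exists and has $\mathrm{ops}(T)=cc(\mathcal N_{\rm IS}(G))$. 1. (All independent sets.) Contracting with expression trees and $x_v=\mathtt{LEAF}(e_v)$ takes exactly $\mathrm{ops}(T)$ additions and multiplications of tensor elements, and as many tree operations, and gives an expression tree that represents the set of all independent sets of $G$. 2. (Independent sets of size $k>\alpha(G)-K$.) For every $K\ge 1$, contracting with polynomials truncated to the $K$ largest orders and $x_v=\mathtt{LEAF}(e_v)\,x$, and joining the at most $K$ coefficients of the result by $\mathtt{SUM}$ nodes, takes exactly $\mathrm{ops}(T)$ additions and multiplications of tensor elements, creates at most $K^2\,\mathrm{ops}(T)+K$ tree nodes, and gives an expression tree that represents the set of all independent sets of $G$ of size larger than $\alpha(G)-K$. In both cases, for every $M\ge 0$, drawing $M$ samples from the tree gives $M$ independent, exactly uniformly distributed elements of the represented set. The total time, that is, the number of additions and multiplications of tensor elements plus the cost of all the samples, is in every run at most $$\mathrm{ops}(T)+C\,|V|\,(|V|+|E|)\,M,$$ and, if $G$ has no isolated vertices, at most $$\mathrm{ops}(T)+C\,|V|\,|E|\,M .$$ For an optimal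 $T$ the latter is $cc(\mathcal N_{\rm IS}(G))+O(|V|\,|E|\,M)$. -/

import Mathlib

/-! Generic tensor networks over two-valued labels, the sum-product expression trees, and the
sampling of independent sets from them, with explicit operation counts. -/

namespace SumProductSampling

/-! ### Counting operations -/

/-- The outcome of a deterministic computation together with two counters: `elemOps` counts the
additions and multiplications of tensor elements, `treeOps` counts the tree nodes that have been
created (each `SUM` or `PROD` node costs one). -/
structure Timed (α : Type*) where
  val : α
  elemOps : ℕ
  treeOps : ℕ

namespace Timed

/-- A value that is available for free. -/
def ret {α : Type*} (a : α) : Timed α := ⟨a, 0, 0⟩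

/-- Sequential composition; the counters add up. -/
def bind {α β : Type*} (x : Timed α) (f : α → Timed β) : Timed β :=
  ⟨(f x.val).val, x.elemOps + (f x.val).elemOps, x.treeOps + (f x.val).treeOps⟩

/-- Charge one operation on tensor elements. -/
def tickElem {α : Type*} (x : Timed α) : Timed α := ⟨x.val, x.elemOps + 1, x.treeOps⟩

/-- Charge the creation of one tree node. -/
def tickTree {α : Type*} (x : Timed α) : Timed α := ⟨x.val, x.elemOps, x.treeOps + 1⟩

end Timed

/-! ### Contraction of tensor networks -/

/-- A type of tensor elements: the two constants and the two operations, each operation with the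
number of tree nodes it creates. -/
structure ElementType (R : Type*) where
  zero : R
  one : R
  add : R → R → Timed R
  mul : R → R → Timed R

/-- A tensor whose indices are labels taking the values `0` and `1`. An assignment of the labels is
given by the set `a ⊆ labels` of the labels with value `1`; only the entries at `a ⊆ labels` are
stored and used. -/
structure Tensor (L : Type*) (R : Type*) where
  labels : Finset L
  entry : Finset L → R

/-- A tensor network with input tensors indexed by `ι` and with a scalar (rank zero) output. -/
structure TensorNetwork (ι : Type*) (L : Type*) (R : Type*) where
  labels : ι → Finset L
  entry : ι → Finset L → R

/-- Binary trees with leaves in `ι`: candidates for pairwise contraction orders. -/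
inductive ContractionTree (ι : Type*) where
  | leaf (i : ι) : ContractionTree ι
  | node (l r : ContractionTree ι) : ContractionTree ι

namespace ContractionTree

/-- The leaves, from left to right. -/
def leaves {ι : Type*} : ContractionTree ι → List ι
  | leaf i => [i]
  | node l r => l.leaves ++ r.leaves

/-- `T` is a contraction order of a network with tensors indexed by `ι`: every tensor is a leaf of
`T` exactly once. -/
def IsOrder {ι : Type*} (T : ContractionTree ι) : Prop :=
  T.leaves.Nodup ∧ ∀ i, i ∈ T.leaves

variable {ι L : Type*} [Fintype ι] [DecidableEq ι] [Fintype L] [DecidableEq L]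

/-- The labels of the intermediate tensor that belongs to the subtree `t`: those that occur in one
of the tensors below `t` and also in a tensor that is not below `t`. All the other labels below `t`
have been summed over. -/
def openLabels (labels : ι → Finset L) (t : ContractionTree ι) : Finset L :=
  Finset.univ.filter fun x =>
    (∃ i, i ∈ t.leaves ∧ x ∈ labels i) ∧ ∃ j, j ∉ t.leaves ∧ x ∈ labels j

/-- The number of additions and multiplications of tensor elements in the pairwise contraction
along `t`. If the two operands of a contraction have the labels `U` in total, and the labels `S ⊆ U`
remain, then there are `2 ^ |U|` multiplications and `2 ^ |U| - 2 ^ |S|` additions. -/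
def opCount (labels : ι → Finset L) : ContractionTree ι → ℕ
  | leaf i => 2 ^ (labels i).card - 2 ^ ((leaf i).openLabels labels).card
  | node l r =>
      l.opCount labels + r.opCount labels
        + 2 ^ (l.openLabels labels ∪ r.openLabels labels).card
        + (2 ^ (l.openLabels labels ∪ r.openLabels labels).card
            - 2 ^ ((node l r).openLabels labels).card)

end ContractionTree

/-- The contraction complexity of a network whose tensors carry the given labels: the smallest
number of additions and multiplications over all the pairwise contraction orders. -/
noncomputable def contractionComplexity {ι L : Type*} [Fintype ι] [DecidableEq ι] [Fintype L]
    [DecidableEq L] (labels : ι → Finset L) : ℕ :=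
  sInf {n | ∃ T : ContractionTree ι, T.IsOrder ∧ T.opCount labels = n}

section Contraction

variable {ι L R : Type*}

/-- Compute all the entries of a tensor with labels `S`; the costs of the entries add up. -/
def tabulate (S : Finset L) (f : Finset L → Timed R) : Timed (Tensor L R) :=
  ⟨⟨S, fun a => (f a).val⟩, ∑ a ∈ S.powerset, (f a).elemOps, ∑ a ∈ S.powerset, (f a).treeOps⟩

variable [DecidableEq L]

/-- The entrywise product of two tensors over the union of their labels. -/
def mulTensor (A : ElementType R) (S T : Tensor L R) : Timed (Tensor L R) :=
  tabulate (S.labels ∪ T.labels) fun a =>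
    (A.mul (S.entry (a ∩ S.labels)) (T.entry (a ∩ T.labels))).tickElem

/-- Summation over the two values of the label `x`. -/
def sumLabel (A : ElementType R) (T : Tensor L R) (x : L) : Timed (Tensor L R) :=
  tabulate (T.labels.erase x) fun a => (A.add (T.entry a) (T.entry (insert x a))).tickElem

/-- Summation over a list of labels, one after the other. -/
def sumLabels (A : ElementType R) : List L → Tensor L R → Timed (Tensor L R)
  | [], T => .ret T
  | x :: xs, T => (sumLabel A T x).bind (sumLabels A xs)

end Contraction

section Contract

variable {ι L R : Type*} [Fintype ι] [DecidableEq ι] [Fintype L] [LinearOrder L]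

/-- Pairwise contraction along a tree: multiply the two intermediate tensors, then sum over all
the labels that do not occur outside the subtree (in the order of the labels). -/
def contract (A : ElementType R)
    (N : TensorNetwork ι L R) : ContractionTree ι → Timed (Tensor L R)
  | .leaf i =>
      sumLabels A ((N.labels i \ (ContractionTree.leaf i).openLabels N.labels).sort (· ≤ ·))
        ⟨N.labels i, N.entry i⟩
  | .node l r =>
      (contract A N l).bind fun S =>
      (contract A N r).bind fun T =>
      (mulTensor A S T).bind fun P =>
        sumLabels A ((P.labels \ (ContractionTree.node l r).openLabels N.labels).sort (· ≤ ·)) P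

/-- The contraction of a whole network with scalar output. -/
def contractScalar (A : ElementType R) (N : TensorNetwork ι L R)
    (T : ContractionTree ι) : Timed R :=
  (contract A N T).bind fun S => .ret (S.entry ∅)

end Contract

/-! ### The tensor network of the independent set problem -/

section Network

variable {V : Type*} [DecidableEq V] (G : SimpleGraph V)

/-- One tensor with label `v` for each vertex `v`, and one tensor with labels `u, v` for each edge
`{u, v}`. -/
def misLabels : V ⊕ G.edgeSet → Finset V
  | .inl v => {v}
  | .inr e => (e : Sym2 V).toFinset

/-- The vertex tensors are `(1, x v)`, the edge tensors are `((1, 1), (1, 0))`. -/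
def misNetwork {R : Type*} (A : ElementType R) (x : V → R) :
    TensorNetwork (V ⊕ G.edgeSet) V R where
  labels := misLabels G
  entry
    | .inl v, a => if v ∈ a then x v else A.one
    | .inr e, a => if (e : Sym2 V).toFinset ⊆ a then A.zero else A.one

/-- The contraction complexity of the network of the independent set problem on `G`. -/
noncomputable def misComplexity [Fintype V] [DecidableRel G.Adj] : ℕ :=
  contractionComplexity (misLabels G)

end Network

/-! ### Sum-product expression trees -/

/-- Bit strings with one bit for each vertex. -/
abbrev BitString (V : Type*) := V → Bool

/-- Bitwise or. -/
def bitOr {V : Type*} (σ τ : BitString V) : BitString V := fun v => σ v || τ v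

/-- The bit string `00…0`. -/
def zeroBits (V : Type*) : BitString V := fun _ => false

/-- The bit string whose only non-zero bit is at `v`. -/
def unitBits {V : Type*} [DecidableEq V] (v : V) : BitString V := fun u => decide (u = v)

/-- Sum-product expression trees. Operands are shared, not copied, so creating a node is one step.
A `SUM` or `PROD` node also stores its size (the number of configurations it represents), which is
obtained from the sizes of its two operands by one arithmetic operation when it is created. -/
inductive ExprTree (V : Type*) where
  | leaf (σ : BitString V) : ExprTree V
  | zero : ExprTree V
  | sum (sz : ℕ) (l r : ExprTree V) : ExprTree V
  | prod (sz : ℕ) (l r : ExprTree V) : ExprTree V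

namespace ExprTree

variable {V : Type*}

/-- The size, as read off from the root node. -/
def size : ExprTree V → ℕ
  | leaf _ => 1
  | zero => 0
  | sum s _ _ => s
  | prod s _ _ => s

/-- Create a `SUM` node. -/
def mkSum (l r : ExprTree V) : Timed (ExprTree V) :=
  (Timed.ret (sum (l.size + r.size) l r)).tickTree

/-- Create a `PROD` node. -/
def mkProd (l r : ExprTree V) : Timed (ExprTree V) :=
  (Timed.ret (prod (l.size * r.size) l r)).tickTree

/-- The set of bit strings that a tree represents: `SUM` is the union, `PROD` is the elementwise
bitwise or. -/
def expand [Fintype V] : ExprTree V → Finset (BitString V)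
  | leaf σ => {σ}
  | zero => ∅
  | sum _ l r => l.expand ∪ r.expand
  | prod _ l r => Finset.image₂ bitOr l.expand r.expand

/-- Expression trees as tensor elements. -/
def elements (V : Type*) : ElementType (ExprTree V) where
  zero := zero
  one := leaf (zeroBits V)
  add := mkSum
  mul := mkProd

/-- The sum of a list of trees, by repeated halving of the list. -/
def sumList : List (ExprTree V) → Timed (ExprTree V)
  | [] => .ret zero
  | [t] => .ret t
  | t₁ :: t₂ :: ts =>
      (sumList ((t₁ :: t₂ :: ts).take ((ts.length + 2) / 2))).bind fun l =>
      (sumList ((t₁ :: t₂ :: ts).drop ((ts.length + 2) / 2))).bind fun r => mkSum l r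
  termination_by ts => ts.length
  decreasing_by
    · simp only [List.length_take, List.length_cons]; omega
    · simp only [List.length_drop, List.length_cons]; omega

end ExprTree

/-! ### Truncated polynomials with expression trees as coefficients -/

/-- A polynomial of which only the largest orders are kept: `coeffs` lists the coefficients of
`x ^ order, x ^ (order - 1), …`. The zero polynomial has no coefficients. -/
structure TruncPoly (V : Type*) where
  order : ℕ
  coeffs : List (ExprTree V)

namespace TruncPoly

variable {V : Type*}

/-- Add two lists of coefficients entry by entry. -/
def addCoeffs : List (ExprTree V) → List (ExprTree V) → Timed (List (ExprTree V))
  | [], bs => .ret bs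
  | as, [] => .ret as
  | a :: as, b :: bs =>
      (ExprTree.mkSum a b).bind fun c => (addCoeffs as bs).bind fun cs => .ret (c :: cs)

/-- Run a list of computations one after the other. -/
def runList {α : Type*} : List (Timed α) → Timed (List α)
  | [] => .ret []
  | x :: xs => x.bind fun a => (runList xs).bind fun as => .ret (a :: as)

/-- Addition: align the two lists at the larger one of the two orders and keep the `K` largest
orders. -/
def add (K : ℕ) (p q : TruncPoly V) : Timed (TruncPoly V) :=
  if p.coeffs.isEmpty then .ret q
  else if q.coeffs.isEmpty then .ret p
  else
    (addCoeffs
        ((List.replicate (q.order - p.order) ExprTree.zero ++ p.coeffs).take K)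
        ((List.replicate (p.order - q.order) ExprTree.zero ++ q.coeffs).take K)).bind fun cs =>
      .ret ⟨max p.order q.order, cs⟩

/-- The coefficient with index `j` of the product: the sum of `aᵢ ⊙ b₍ⱼ₋ᵢ₎`. -/
def convCoeff (as bs : List (ExprTree V)) (j : ℕ) : Timed (ExprTree V) :=
  (runList ((List.range (j + 1)).filterMap fun i =>
      match as[i]?, bs[j - i]? with
      | some a, some b => some (ExprTree.mkProd a b)
      | _, _ => none)).bind ExprTree.sumList

/-- Multiplication: the orders add up, the coefficients are convolved, and the `K` largest orders
are kept. -/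
def mul (K : ℕ) (p q : TruncPoly V) : Timed (TruncPoly V) :=
  if p.coeffs.isEmpty || q.coeffs.isEmpty then .ret ⟨0, []⟩
  else
    (runList ((List.range (min K (p.coeffs.length + q.coeffs.length - 1))).map
        (convCoeff p.coeffs q.coeffs))).bind fun cs =>
      .ret ⟨p.order + q.order, cs⟩

/-- Polynomials truncated to the `K` largest orders, with expression trees as coefficients, as
tensor elements. -/
def elements (V : Type*) (K : ℕ) : ElementType (TruncPoly V) where
  zero := ⟨0, []⟩
  one := ⟨0, [.leaf (zeroBits V)]⟩
  add := add K
  mul := mul K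

end TruncPoly

/-! ### Building the tree -/

section Build

variable {V : Type*} [Fintype V] [LinearOrder V] (G : SimpleGraph V) [DecidableRel G.Adj]

/-- The expression tree of all the independent sets: contract the network with
`x v = (LEAF, e_v)`. -/
def buildAll (T : ContractionTree (V ⊕ G.edgeSet)) : Timed (ExprTree V) :=
  contractScalar (ExprTree.elements V)
    (misNetwork G (ExprTree.elements V) fun v => .leaf (unitBits v)) T

/-- The expression tree of the independent sets of the `K` largest sizes: contract the network of
truncated polynomials with `x v = (LEAF, e_v) x`, then join the coefficients of the result by `SUM`
nodes. -/
def buildLarge (K : ℕ) (T : ContractionTree (V ⊕ G.edgeSet)) : Timed (ExprTree V) :=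
  (contractScalar (TruncPoly.elements V K)
    (misNetwork G (TruncPoly.elements V K) fun v => ⟨1, [.leaf (unitBits v)]⟩) T).bind fun p =>
      ExprTree.sumList p.coeffs

end Build

/-! ### Sampling from a tree -/

/-- A uniformly random natural number below `N` (and `0` if `N = 0`). -/
noncomputable def drawBelow : ℕ → PMF ℕ
  | 0 => PMF.pure 0
  | N + 1 => (PMF.uniformOfFintype (Fin (N + 1))).map Fin.val

/-- One random sample, with the number of bit operations spent on it, by recursive descent. At a
`SUM` node the descent continues in one of the two operands, chosen with probabilities proportional
to their sizes: a random number below the total size is drawn and compared, at the cost of the bit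
lengths of the numbers involved. At a `PROD` node it continues in both operands and the two
results are combined by bitwise or, at the cost of one operation per bit. Writing the bit string of
a `LEAF` costs one operation per bit. Moreover each visited node costs one operation. A `ZERO` node
has size `0`; the string returned there is a dummy. -/
noncomputable def sample {V : Type*} [Fintype V] : ExprTree V → PMF (BitString V × ℕ)
  | .leaf σ => PMF.pure (σ, Fintype.card V + 1)
  | .zero => PMF.pure (zeroBits V, Fintype.card V + 1)
  | .sum _ l r =>
      (drawBelow (l.size + r.size)).bind fun k =>
        (if k < l.size then sample l else sample r).map fun x =>
          (x.1, x.2 + (l.size.size + r.size.size + (l.size + r.size).size + 1))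
  | .prod _ l r =>
      (sample l).bind fun x => (sample r).map fun y =>
        (bitOr x.1 y.1, x.2 + y.2 + (Fintype.card V + 1))

/-- `M` samples, drawn one after the other with fresh randomness, and the total cost. -/
noncomputable def sampleMany {V : Type*} [Fintype V] (t : ExprTree V) :
    (M : ℕ) → PMF ((Fin M → BitString V) × ℕ)
  | 0 => PMF.pure (fun i => i.elim0, 0)
  | M + 1 =>
      (sample t).bind fun x => (sampleMany t M).map fun y => (Fin.cons x.1 y.1, x.2 + y.2)

/-- The whole algorithm: build the tree once, then draw `M` samples from it. The total time is the
number of additions and multiplications of tensor elements in the building phase plus the cost of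
the samples. -/
noncomputable def buildAndSample {V : Type*} [Fintype V] (b : Timed (ExprTree V)) (M : ℕ) :
    PMF ((Fin M → BitString V) × ℕ) :=
  (sampleMany b.val M).map fun r => (r.1, b.elemOps + r.2)

/-! ### The sampled sets -/

section Target

variable {V : Type*} [Fintype V] (G : SimpleGraph V)

/-- The set of vertices that a bit string describes. -/
def BitString.support (σ : BitString V) : Finset V := Finset.univ.filter fun v => σ v = true

open Classical in
/-- The bit strings of all the independent sets of `G`. -/
noncomputable def indepStrings : Finset (BitString V) :=
  Finset.univ.filter fun σ => G.IsIndepSet (BitString.support σ : Set V)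

open Classical in
/-- The bit strings of the independent sets of `G` of size larger than `α(G) - K`. -/
noncomputable def largeIndepStrings (K : ℕ) : Finset (BitString V) :=
  Finset.univ.filter fun σ =>
    G.IsIndepSet (BitString.support σ : Set V) ∧ G.indepNum < (BitString.support σ).card + K

/-- The first component of `P` is a vector of independent uniformly random elements of `S`. -/
def IsUniformSample {M : ℕ} (P : PMF ((Fin M → BitString V) × ℕ)) (S : Finset (BitString V)) :
    Prop :=
  ∃ h : (Fintype.piFinset fun _ : Fin M => S).Nonempty,
    P.map Prod.fst = PMF.uniformOfFinset (Fintype.piFinset fun _ : Fin M => S) h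

end Target

end SumProductSampling

/-! Contraction is generic in the tensor elements, so correctness, operation count and sampling cost
come from one induction over the contraction tree.

Correctness: the entry at `a` of the intermediate tensor of a subtree `t` stands for `partialStrings
G t X a`: vertex sets that agree with `a` on the labels `X` still present and contain no edge of
`t`, restricted to the vertices whose tensors lie in `t`. A label is summed only after its vertex
tensor has been absorbed, so the two summands differ in that bit and every union is disjoint. The
operands of a product involve disjoint vertex sets, so bitwise or is injective on pairs. Hence the
stored sizes are true cardinalities and the descent is uniform (`Samples`). `IsSemantics` isolates
these closure properties; `rep_contract` runs the induction for any instance, and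
`isSemantics_repTree` and `isSemantics_repPoly` supply the two needed. At the root no label is open
and the set is that of all independent sets.

Truncation is harmless because the recorded order is always the largest size that occurs, and the
top `K` layers of a sum or product depend only on the top `K` layers of the operands; at the root
the order is `α(G)`.

Sampling cost: one descent visits at most one leaf entry per input tensor and one `PROD` per inner
node, at `|V| + 1` each; each of the at most `|V|` labels is summed once, at `O(|V|)`; and a
convolution costs at most `10 |X| |Y|`, where `X` and `Y` are the vertex sets of the operands, which
telescopes to `5 |V|²` (`costBound_le`). None of this depends on `K` or on the tree `T`. -/

set_option linter.unusedSectionVars false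

/-! ### Uniform sampling from expression trees. -/

namespace SumProductSampling

open scoped ENNReal

variable {V : Type*} [Fintype V]

lemma drawBelow_apply (N k : ℕ) (hN : 0 < N) :
    drawBelow N k = if k < N then (N : ℝ≥0∞)⁻¹ else 0 := by
  obtain ⟨n, rfl⟩ := Nat.exists_eq_succ_of_ne_zero hN.ne'
  rw [drawBelow, PMF.map_apply, tsum_fintype]
  split_ifs with h
  · rw [Finset.sum_eq_single (⟨k, h⟩ : Fin (n + 1))]
    · simp
    · intro b _ hb
      rw [if_neg]
      rintro rfl
      exact hb rfl
    · simp
  · refine Finset.sum_eq_zero fun b _ => if_neg ?_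
    rintro rfl
    exact h b.2

/-- `e` represents the set `S`, its stored size is right, sampling from it is uniform, and each
sample costs at most `c`. -/
structure Samples (e : ExprTree V) (S : Finset (BitString V)) (c : ℕ) : Prop where
  expand_eq : e.expand = S
  size_eq : e.size = S.card
  uniform : ∀ σ, (e.size : ℝ≥0∞) * ((sample e).map Prod.fst) σ = if σ ∈ S then 1 else 0
  cost_le : S.Nonempty → ∀ r ∈ (sample e).support, r.2 ≤ c

namespace Samples

variable {e l r : ExprTree V} {S T : Finset (BitString V)} {c d : ℕ}

lemma mono (h : Samples e S c) (hcd : c ≤ d) : Samples e S d :=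
  ⟨h.expand_eq, h.size_eq, h.uniform, fun hS x hx => (h.cost_le hS x hx).trans hcd⟩

/-- The cost bound `c` is arbitrary because `Samples` restricts cost only for nonempty sets: a
descent starting from positive size never enters a `ZERO` node. -/
lemma zero (c : ℕ) : Samples (.zero : ExprTree V) ∅ c :=
  ⟨rfl, rfl, by simp [ExprTree.size], by simp⟩

lemma eq_empty (h : Samples (.zero : ExprTree V) S c) : S = ∅ := h.expand_eq.symm

lemma leaf (σ : BitString V) : Samples (.leaf σ) {σ} (Fintype.card V + 1) where
  expand_eq := rfl
  size_eq := rfl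
  uniform τ := by simp [sample, ExprTree.size, PMF.pure_map, PMF.pure_apply]
  cost_le _ x hx := by
    simp only [sample, PMF.support_pure, Set.mem_singleton_iff] at hx
    simp [hx]

lemma sample_sum_fst (sz : ℕ) (l r : ExprTree V) :
    (sample (.sum sz l r)).map Prod.fst = (drawBelow (l.size + r.size)).bind fun k =>
      if k < l.size then (sample l).map Prod.fst else (sample r).map Prod.fst := by
  rw [sample, PMF.map_bind]
  congr 1
  funext k
  rw [PMF.map_comp]
  split_ifs <;> rfl

lemma sample_prod_fst (sz : ℕ) (l r : ExprTree V) :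
    (sample (.prod sz l r)).map Prod.fst = ((sample l).map Prod.fst).bind fun x =>
      ((sample r).map Prod.fst).map (bitOr x) := by
  rw [sample, PMF.map_bind, PMF.bind_map]
  congr 1
  funext x
  rw [PMF.map_comp]
  simp only [Function.comp_apply]
  rw [PMF.map_comp]
  rfl

/-- Choosing an operand with probability proportional to its size cancels the operand's own
normalization, and disjointness keeps any string from being counted twice. All three sizes are at
most `2 ^ n`, so they have at most `n + 1` bits each: `3 * (n + 1) + 1 = 3 * n + 4`. -/
lemma mkSum (hl : Samples l S c) (hr : Samples r T c) (hST : Disjoint S T) {n : ℕ}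
    (hn : (S ∪ T).card ≤ 2 ^ n) :
    Samples (ExprTree.mkSum l r).val (S ∪ T) (c + (3 * n + 4)) where
  expand_eq := by
    simp [ExprTree.mkSum, Timed.tickTree, Timed.ret, ExprTree.expand, hl.expand_eq, hr.expand_eq]
  size_eq := by
    change l.size + r.size = _
    rw [hl.size_eq, hr.size_eq, Finset.card_union_of_disjoint hST]
  uniform σ := by
    have key : ((l.size + r.size : ℕ) : ℝ≥0∞) *
        ((sample (.sum (l.size + r.size) l r)).map Prod.fst) σ =
        l.size * ((sample l).map Prod.fst) σ + r.size * ((sample r).map Prod.fst) σ := by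
      -- With uniformity stated as size times probability, the degenerate case of two empty operands
      -- reads `0 = 0`.
      rcases Nat.eq_zero_or_pos (l.size + r.size) with h0 | hpos
      · have h1 : l.size = 0 := by omega
        have h2 : r.size = 0 := by omega
        simp [h1, h2]
      rw [sample_sum_fst, PMF.bind_apply,
        tsum_eq_sum (s := Finset.range (l.size + r.size)) (fun k hk => by
          rw [drawBelow_apply _ _ hpos, if_neg (by simpa using hk), zero_mul]),
        Finset.sum_congr rfl (fun k hk => by
          rw [drawBelow_apply _ _ hpos, if_pos (by simpa using hk)]),
        ← Finset.mul_sum, ← mul_assoc, ENNReal.mul_inv_cancel (by exact_mod_cast hpos.ne')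
          (ENNReal.natCast_ne_top _), one_mul, Finset.sum_range_add]
      congr 1
      · rw [Finset.sum_congr rfl (fun k hk => by rw [if_pos (by simpa using hk)])]
        simp
      · rw [Finset.sum_congr rfl (fun k hk => by rw [if_neg (by omega)])]
        simp
    refine key.trans ?_
    rw [hl.uniform, hr.uniform]
    by_cases h1 : σ ∈ S
    · have h2 : σ ∉ T := Finset.disjoint_left.mp hST h1
      simp [h1, h2]
    · simp [h1]
  cost_le hne x hx := by
    change x ∈ (sample (.sum (l.size + r.size) l r)).support at hx
    have hcard : l.size + r.size = (S ∪ T).card := by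
      rw [hl.size_eq, hr.size_eq, Finset.card_union_of_disjoint hST]
    have hpos : 0 < l.size + r.size := hcard ▸ hne.card_pos
    rw [sample, PMF.mem_support_bind_iff] at hx
    obtain ⟨k, hk, hx⟩ := hx
    have hkN : k < l.size + r.size := by
      by_contra h
      rw [PMF.mem_support_iff, drawBelow_apply _ _ hpos, if_neg h] at hk
      exact hk rfl
    rw [PMF.mem_support_map_iff] at hx
    obtain ⟨y, hy, rfl⟩ := hx
    have hs : ∀ m ≤ l.size + r.size, m.size ≤ n + 1 := fun m hm => by
      rw [Nat.size_le]
      exact (hm.trans (hcard ▸ hn)).trans_lt (Nat.pow_lt_pow_right (by norm_num) (by omega))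
    have h1 := hs l.size (by omega)
    have h2 := hs r.size (by omega)
    have h3 := hs _ le_rfl
    -- The operand that is entered has positive size, so its cost bound applies.
    have hyc : y.2 ≤ c := by
      split_ifs at hy with h
      · exact hl.cost_le (Finset.card_pos.mp (by rw [← hl.size_eq]; omega)) y hy
      · exact hr.cost_le (Finset.card_pos.mp (by rw [← hr.size_eq]; omega)) y hy
    simp only
    omega

/-- Injectivity of bitwise or on `S × T` makes the size multiplicative and leaves a single pair
contributing to the probability of each string. -/
lemma mkProd (hl : Samples l S c) (hr : Samples r T d)
    (hinj : ∀ x ∈ S, ∀ y ∈ T, ∀ x' ∈ S, ∀ y' ∈ T, bitOr x y = bitOr x' y' → x = x' ∧ y = y') :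
    Samples (ExprTree.mkProd l r).val (Finset.image₂ bitOr S T)
      (c + d + (Fintype.card V + 1)) where
  expand_eq := by
    simp [ExprTree.mkProd, Timed.tickTree, Timed.ret, ExprTree.expand, hl.expand_eq, hr.expand_eq]
  size_eq := by
    change l.size * r.size = _
    rw [hl.size_eq, hr.size_eq, eq_comm, Finset.card_image₂_iff]
    rintro ⟨x, y⟩ hx ⟨x', y'⟩ hx' h
    simp only [Set.mem_prod, Finset.mem_coe] at hx hx'
    obtain ⟨rfl, rfl⟩ := hinj x hx.1 y hx.2 x' hx'.1 y' hx'.2 h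
    rfl
  uniform σ := by
    classical
    change ((l.size * r.size : ℕ) : ℝ≥0∞) *
      ((sample (.prod (l.size * r.size) l r)).map Prod.fst) σ = _
    have key : ((l.size * r.size : ℕ) : ℝ≥0∞) *
        ((sample (.prod (l.size * r.size) l r)).map Prod.fst) σ =
        ∑ x : BitString V, ∑ y : BitString V,
          (l.size * ((sample l).map Prod.fst) x) * (if σ = bitOr x y then
            r.size * ((sample r).map Prod.fst) y else 0) := by
      rw [sample_prod_fst, PMF.bind_apply, tsum_fintype, Finset.mul_sum]
      refine Finset.sum_congr rfl fun x _ => ?_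
      rw [PMF.map_apply (bitOr x), tsum_fintype, Finset.mul_sum, Finset.mul_sum]
      refine Finset.sum_congr rfl fun y _ => ?_
      push_cast
      split_ifs <;> ring
    rw [key]
    simp_rw [hl.uniform, hr.uniform]
    split_ifs with h
    · obtain ⟨x, hx, y, hy, rfl⟩ := Finset.mem_image₂.mp h
      rw [Finset.sum_eq_single x, Finset.sum_eq_single y]
      · simp [hx, hy]
      · intro y' _ hne
        by_cases hy' : y' ∈ T
        · rw [if_neg (fun he => hne (hinj x hx y hy x hx y' hy' he).2.symm), mul_zero]
        · simp [hy']
      · simp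
      · intro x' _ hne
        refine Finset.sum_eq_zero fun y' _ => ?_
        by_cases hx' : x' ∈ S
        · by_cases hy' : y' ∈ T
          · rw [if_neg (fun he => hne (hinj x hx y hy x' hx' y' hy' he).1.symm), mul_zero]
          · simp [hy']
        · simp [hx']
      · simp
    · refine Finset.sum_eq_zero fun x _ => Finset.sum_eq_zero fun y _ => ?_
      by_cases hx : x ∈ S
      · by_cases hy : y ∈ T
        · rw [if_neg (c := σ = bitOr x y), mul_zero]
          rintro rfl
          exact h (Finset.mem_image₂_of_mem hx hy)
        · simp [hy]
      · simp [hx]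
  cost_le hne x hx := by
    change x ∈ (sample (.prod (l.size * r.size) l r)).support at hx
    rw [sample, PMF.mem_support_bind_iff] at hx
    obtain ⟨y, hy, hx⟩ := hx
    rw [PMF.mem_support_map_iff] at hx
    obtain ⟨z, hz, rfl⟩ := hx
    have h1 := hl.cost_le hne.of_image₂_left y hy
    have h2 := hr.cost_le hne.of_image₂_right z hz
    simp only
    omega

end Samples

lemma sumList_cons_cons (t₁ t₂ : ExprTree V) (ts : List (ExprTree V)) :
    ExprTree.sumList (t₁ :: t₂ :: ts) =
      (ExprTree.sumList ((t₁ :: t₂ :: ts).take ((t₁ :: t₂ :: ts).length / 2))).bind fun l =>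
      (ExprTree.sumList ((t₁ :: t₂ :: ts).drop ((t₁ :: t₂ :: ts).length / 2))).bind fun r =>
        ExprTree.mkSum l r := by
  rw [ExprTree.sumList]
  rfl

/-- Halving a list of at most `2 ^ k` trees gives depth at most `k`, and each level passed on the
way down costs at most `3 * n + 4`. -/
lemma Samples.sumList {α : Type*} [DecidableEq α] (f : α → ExprTree V)
    (S : α → Finset (BitString V)) {c n : ℕ} :
    ∀ (k : ℕ) (l : List α), l.length ≤ 2 ^ k → l.Nodup → (∀ a ∈ l, Samples (f a) (S a) c) →
      (∀ a ∈ l, ∀ b ∈ l, a ≠ b → Disjoint (S a) (S b)) →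
      (l.toFinset.biUnion S).card ≤ 2 ^ n →
      Samples (ExprTree.sumList (l.map f)).val (l.toFinset.biUnion S) (c + k * (3 * n + 4)) := by
  intro k
  induction k with
  | zero =>
    intro l hl _ hf _ _
    match l, hl with
    | [], _ => simpa [ExprTree.sumList, Timed.ret] using Samples.zero (V := V) c
    | [a], _ => simpa [ExprTree.sumList, Timed.ret] using hf a (by simp)
  | succ k ih =>
    intro l hl hnd hf hdis hcard
    match l, hl with
    | [], _ => simpa [ExprTree.sumList, Timed.ret] using Samples.zero (V := V) _
    | [a], _ =>
      simpa [ExprTree.sumList, Timed.ret] using (hf a (by simp)).mono (Nat.le_add_right _ _)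
    | a :: b :: l', hl =>
      rw [List.map_cons, List.map_cons, sumList_cons_cons, ← List.map_cons, ← List.map_cons,
        ← List.map_take, ← List.map_drop, List.length_map]
      generalize a :: b :: l' = l at *
      set m := l.length / 2 with hm
      have hpow : 2 ^ (k + 1) = 2 * 2 ^ k := by ring
      have hsplit : (l.take m).toFinset.biUnion S ∪ (l.drop m).toFinset.biUnion S =
          l.toFinset.biUnion S := by
        rw [← Finset.union_biUnion, ← List.toFinset_append, List.take_append_drop]
      have h1 : (l.take m).length ≤ 2 ^ k := by rw [List.length_take]; omega
      have h2 : (l.drop m).length ≤ 2 ^ k := by rw [List.length_drop]; omega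
      have hndd : (l.take m ++ l.drop m).Nodup := by rwa [List.take_append_drop]
      have m1 : ∀ x ∈ l.take m, x ∈ l := fun x hx => List.mem_of_mem_take hx
      have m2 : ∀ x ∈ l.drop m, x ∈ l := fun x hx => List.mem_of_mem_drop hx
      have A := ih (l.take m) h1 (List.nodup_append.mp hndd).1 (fun x hx => hf x (m1 x hx))
        (fun x hx y hy => hdis x (m1 x hx) y (m1 y hy))
        ((Finset.card_le_card (hsplit ▸ Finset.subset_union_left)).trans hcard)
      have B := ih (l.drop m) h2 (List.nodup_append.mp hndd).2.1 (fun x hx => hf x (m2 x hx))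
        (fun x hx y hy => hdis x (m2 x hx) y (m2 y hy))
        ((Finset.card_le_card (hsplit ▸ Finset.subset_union_right)).trans hcard)
      have hd : Disjoint ((l.take m).toFinset.biUnion S) ((l.drop m).toFinset.biUnion S) := by
        rw [Finset.disjoint_biUnion_left]
        intro x hx
        rw [Finset.disjoint_biUnion_right]
        intro y hy
        rw [List.mem_toFinset] at hx hy
        exact hdis x (m1 x hx) y (m2 y hy) ((List.nodup_append.mp hndd).2.2 x hx y hy)
      have := A.mkSum B hd (n := n) (by rwa [hsplit])
      rw [hsplit] at this
      refine this.mono ?_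
      ring_nf
      omega

lemma sumList_treeOps_le (ts : List (ExprTree V)) :
    (ExprTree.sumList ts).treeOps ≤ ts.length - 1 := by
  induction hn : ts.length using Nat.strong_induction_on generalizing ts with
  | _ n ih =>
    subst hn
    match ts with
    | [] => simp [ExprTree.sumList, Timed.ret]
    | [a] => simp [ExprTree.sumList, Timed.ret]
    | a :: b :: l =>
      rw [sumList_cons_cons]
      have hl : 2 ≤ (a :: b :: l).length := by simp
      generalize a :: b :: l = ts at *
      have h1 := ih (ts.take (ts.length / 2)).length (by rw [List.length_take]; omega) _ rfl
      have h2 := ih (ts.drop (ts.length / 2)).length (by rw [List.length_drop]; omega) _ rfl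
      rw [List.length_take] at h1
      rw [List.length_drop] at h2
      simp only [Timed.bind, ExprTree.mkSum, Timed.tickTree, Timed.ret]
      omega

lemma sumList_elemOps (ts : List (ExprTree V)) : (ExprTree.sumList ts).elemOps = 0 := by
  induction hn : ts.length using Nat.strong_induction_on generalizing ts with
  | _ n ih =>
    subst hn
    match ts with
    | [] => simp [ExprTree.sumList, Timed.ret]
    | [a] => simp [ExprTree.sumList, Timed.ret]
    | a :: b :: l =>
      rw [sumList_cons_cons]
      have hl : 2 ≤ (a :: b :: l).length := by simp
      generalize a :: b :: l = ts at *
      simp only [Timed.bind, ExprTree.mkSum, Timed.tickTree, Timed.ret]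
      rw [ih (ts.take (ts.length / 2)).length (by rw [List.length_take]; omega) _ rfl,
        ih (ts.drop (ts.length / 2)).length (by rw [List.length_drop]; omega) _ rfl]

/-- Independence: the law of the vector of samples is the product of the single laws. -/
lemma sampleMany_fst_apply (t : ExprTree V) (M : ℕ) (f : Fin M → BitString V) :
    ((sampleMany t M).map Prod.fst) f = ∏ i, ((sample t).map Prod.fst) (f i) := by
  classical
  induction M with
  | zero =>
    simp only [sampleMany, PMF.pure_map, PMF.pure_apply, Finset.univ_eq_empty, Finset.prod_empty]
    exact if_pos (Subsingleton.elim _ _)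
  | succ M ih =>
    have h : (sampleMany t (M + 1)).map Prod.fst = ((sample t).map Prod.fst).bind fun x =>
        ((sampleMany t M).map Prod.fst).map fun y => (Fin.cons x y : Fin (M + 1) → BitString V) := by
      rw [sampleMany, PMF.map_bind, PMF.bind_map]
      congr 1
      funext x
      rw [PMF.map_comp]
      simp only [Function.comp_apply]
      rw [PMF.map_comp]
      rfl
    rw [h, PMF.bind_apply, tsum_fintype, Fin.prod_univ_succ, Finset.sum_eq_single (f 0)]
    · rw [PMF.map_apply _ (sampleMany t M |>.map Prod.fst), tsum_fintype, Finset.sum_eq_single (Fin.tail f)]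
      · rw [Fin.cons_self_tail, if_pos rfl, ih]
        rfl
      · intro g _ hg
        rw [if_neg]
        rintro h
        exact hg (by rw [h, Fin.tail_cons])
      · simp
    · intro x _ hx
      rw [PMF.map_apply _ (sampleMany t M |>.map Prod.fst), tsum_fintype, Finset.sum_eq_zero,
        mul_zero]
      intro g _
      rw [if_neg]
      rintro h
      exact hx (by rw [h, Fin.cons_zero])
    · simp

lemma Samples.isUniformSample {b : Timed (ExprTree V)} {S : Finset (BitString V)} {c : ℕ}
    (h : Samples b.val S c) (hS : S.Nonempty) (M : ℕ) :
    IsUniformSample (buildAndSample b M) S := by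
  refine ⟨Fintype.piFinset_nonempty.mpr fun _ => hS, ?_⟩
  have hfst : (buildAndSample b M).map Prod.fst = (sampleMany b.val M).map Prod.fst := by
    rw [buildAndSample, PMF.map_comp]
    rfl
  ext f
  have hc0 : (S.card : ℝ≥0∞) ≠ 0 := by exact_mod_cast hS.card_pos.ne'
  -- For nonempty `S` the scaled form of uniformity can be divided by the size.
  have hp : ∀ σ, ((sample b.val).map Prod.fst) σ = if σ ∈ S then (S.card : ℝ≥0∞)⁻¹ else 0 := by
    intro σ
    have := h.uniform σ
    rw [h.size_eq] at this
    rw [← one_mul (((sample b.val).map Prod.fst) σ),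
      ← ENNReal.inv_mul_cancel hc0 (ENNReal.natCast_ne_top _), mul_assoc, this]
    simp
  rw [hfst, sampleMany_fst_apply, PMF.uniformOfFinset_apply]
  simp_rw [hp]
  split_ifs with hf
  · rw [Fintype.mem_piFinset] at hf
    simp [hf, Fintype.card_piFinset, ENNReal.inv_pow]
  · rw [Fintype.mem_piFinset, not_forall] at hf
    obtain ⟨i, hi⟩ := hf
    exact Finset.prod_eq_zero (Finset.mem_univ i) (if_neg hi)

lemma Samples.sampleMany_cost_le {t : ExprTree V} {S : Finset (BitString V)} {c : ℕ}
    (h : Samples t S c) (hS : S.Nonempty) (M : ℕ) :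
    ∀ r ∈ (sampleMany t M).support, r.2 ≤ c * M := by
  induction M with
  | zero => simp [sampleMany]
  | succ M ih =>
    intro r hr
    rw [sampleMany, PMF.mem_support_bind_iff] at hr
    obtain ⟨x, hx, hr⟩ := hr
    rw [PMF.mem_support_map_iff] at hr
    obtain ⟨y, hy, rfl⟩ := hr
    have h1 := h.cost_le hS x hx
    have h2 := ih y hy
    simp only
    rw [Nat.mul_succ]
    omega

lemma Samples.buildAndSample_cost_le {b : Timed (ExprTree V)} {S : Finset (BitString V)} {c : ℕ}
    (h : Samples b.val S c) (hS : S.Nonempty) (M : ℕ) :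
    ∀ r ∈ (buildAndSample b M).support, r.2 ≤ b.elemOps + c * M := by
  intro r hr
  rw [buildAndSample, PMF.mem_support_map_iff] at hr
  obtain ⟨y, hy, rfl⟩ := hr
  exact Nat.add_le_add_left (h.sampleMany_cost_le hS M y hy) _

end SumProductSampling
-- Counting operations along a contraction tree.
namespace SumProductSampling

section OpCount

variable {ι L R : Type*} [Fintype ι] [DecidableEq ι] [Fintype L] [LinearOrder L]

lemma sumLabels_labels (A : ElementType R) (xs : List L) (T : Tensor L R) :
    (sumLabels A xs T).val.labels = T.labels \ xs.toFinset := by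
  induction xs generalizing T with
  | nil => simp [sumLabels, Timed.ret]
  | cons x xs ih =>
    rw [sumLabels, Timed.bind, ih]
    ext y
    simp [sumLabel, tabulate]
    tauto

lemma mem_openLabels {labels : ι → Finset L} {t : ContractionTree ι} {x : L} :
    x ∈ t.openLabels labels ↔
      (∃ i, i ∈ t.leaves ∧ x ∈ labels i) ∧ ∃ j, j ∉ t.leaves ∧ x ∈ labels j := by
  simp [ContractionTree.openLabels]

lemma openLabels_leaf_subset (labels : ι → Finset L) (i : ι) :
    (ContractionTree.leaf i).openLabels labels ⊆ labels i := by
  intro x hx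
  simpa [ContractionTree.leaves] using (mem_openLabels.mp hx).1

lemma openLabels_node_subset (labels : ι → Finset L) (l r : ContractionTree ι) :
    (ContractionTree.node l r).openLabels labels ⊆ l.openLabels labels ∪ r.openLabels labels := by
  intro x hx
  simp only [mem_openLabels, Finset.mem_union, ContractionTree.leaves, List.mem_append] at hx ⊢
  obtain ⟨⟨i, hi, hxi⟩, j, hj, hxj⟩ := hx
  push Not at hj
  rcases hi with hi | hi
  · exact Or.inl ⟨⟨i, hi, hxi⟩, j, hj.1, hxj⟩
  · exact Or.inr ⟨⟨i, hi, hxi⟩, j, hj.2, hxj⟩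

/-- A label open at a node is already open at one of its children, so removing the non-open labels
from the union leaves exactly the open ones. -/
lemma contract_labels (A : ElementType R) (N : TensorNetwork ι L R) (t : ContractionTree ι) :
    (contract A N t).val.labels = t.openLabels N.labels := by
  induction t with
  | leaf i =>
    rw [contract, sumLabels_labels, Finset.sort_toFinset]
    exact Finset.sdiff_sdiff_eq_self (openLabels_leaf_subset N.labels i)
  | node l r ihl ihr =>
    simp only [contract, Timed.bind, mulTensor, tabulate]
    rw [sumLabels_labels, Finset.sort_toFinset]
    simp only [ihl, ihr]
    rw [Finset.sdiff_sdiff_eq_self (openLabels_node_subset _ _ _)]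

/-- Summing one label out of `n` takes `2 ^ (n - 1) = 2 ^ n - 2 ^ (n - 1)` additions, so successive
summations telescope. -/
lemma sumLabels_elemOps {A : ElementType R} (hadd : ∀ a b, (A.add a b).elemOps = 0)
    (xs : List L) (T : Tensor L R) (hnd : xs.Nodup) (hxs : ∀ x ∈ xs, x ∈ T.labels) :
    (sumLabels A xs T).elemOps = 2 ^ T.labels.card - 2 ^ (T.labels \ xs.toFinset).card := by
  induction xs generalizing T with
  | nil => simp [sumLabels, Timed.ret]
  | cons x xs ih =>
    have hx : x ∈ T.labels := hxs x (by simp)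
    have hnd' := List.nodup_cons.mp hnd
    have h1 : T.labels.erase x \ xs.toFinset = T.labels \ (x :: xs).toFinset := by
      ext y
      simp
      tauto
    have h2 : T.labels.card = (T.labels.erase x).card + 1 := (Finset.card_erase_add_one hx).symm
    have h3 : (T.labels \ (x :: xs).toFinset).card ≤ (T.labels.erase x).card := by
      rw [← h1]
      exact Finset.card_le_card Finset.sdiff_subset
    have h4 := Nat.pow_le_pow_right (n := 2) (by norm_num) h3
    rw [sumLabels, Timed.bind]
    simp only
    rw [ih _ hnd'.2]
    · simp only [sumLabel, tabulate, Timed.tickElem, hadd, Finset.sum_const, Finset.card_powerset,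
        smul_eq_mul, zero_add, mul_one]
      rw [h1, h2, pow_succ]
      omega
    · intro y hy
      simp only [sumLabel, tabulate, Finset.mem_erase]
      exact ⟨fun h => hnd'.1 (h ▸ hy), hxs y (by simp [hy])⟩

lemma contract_elemOps {A : ElementType R} (hadd : ∀ a b, (A.add a b).elemOps = 0)
    (hmul : ∀ a b, (A.mul a b).elemOps = 0) (N : TensorNetwork ι L R) (t : ContractionTree ι) :
    (contract A N t).elemOps = t.opCount N.labels := by
  induction t with
  | leaf i =>
    rw [contract, sumLabels_elemOps hadd _ _ (Finset.sort_nodup _ _) (by simp; tauto),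
      Finset.sort_toFinset, ContractionTree.opCount]
    simp only [Finset.sdiff_sdiff_eq_self (openLabels_leaf_subset N.labels i)]
  | node l r ihl ihr =>
    simp only [contract, Timed.bind, ihl, ihr, ContractionTree.opCount]
    rw [sumLabels_elemOps hadd _ _ (Finset.sort_nodup _ _) (by simp; tauto), Finset.sort_toFinset]
    simp only [mulTensor, tabulate, Timed.tickElem, hmul, contract_labels, Finset.sum_const,
      Finset.card_powerset, smul_eq_mul, zero_add, mul_one]
    rw [Finset.sdiff_sdiff_eq_self (openLabels_node_subset _ _ _)]
    ring

lemma sumLabels_treeOps_le {A : ElementType R} {k : ℕ} (hadd : ∀ a b, (A.add a b).treeOps ≤ k)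
    (xs : List L) (T : Tensor L R) :
    (sumLabels A xs T).treeOps ≤ k * (sumLabels A xs T).elemOps := by
  induction xs generalizing T with
  | nil => simp [sumLabels, Timed.ret]
  | cons x xs ih =>
    simp only [sumLabels, Timed.bind, mul_add]
    refine Nat.add_le_add ?_ (ih _)
    simp only [sumLabel, tabulate, Timed.tickElem, Finset.mul_sum]
    exact Finset.sum_le_sum fun a _ => (hadd _ _).trans (Nat.le_mul_of_pos_right _ (by omega))

/-- Each element operation is charged one tick in `elemOps`, so a bound per operation carries over
to the whole contraction. With `k = 1` and the reverse inequality `contract_elemOps_le_treeOps`, the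
two counters agree for expression trees. -/
lemma contract_treeOps_le {A : ElementType R} {k : ℕ} (hadd : ∀ a b, (A.add a b).treeOps ≤ k)
    (hmul : ∀ a b, (A.mul a b).treeOps ≤ k) (N : TensorNetwork ι L R) (t : ContractionTree ι) :
    (contract A N t).treeOps ≤ k * (contract A N t).elemOps := by
  induction t with
  | leaf i => exact sumLabels_treeOps_le hadd _ _
  | node l r ihl ihr =>
    simp only [contract, Timed.bind, mul_add]
    refine Nat.add_le_add ihl (Nat.add_le_add ihr (Nat.add_le_add ?_ (sumLabels_treeOps_le hadd _ _)))
    simp only [mulTensor, tabulate, Timed.tickElem, Finset.mul_sum]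
    exact Finset.sum_le_sum fun a _ => (hmul _ _).trans (Nat.le_mul_of_pos_right _ (by omega))

lemma sumLabels_elemOps_le_treeOps {A : ElementType R} (hadd0 : ∀ a b, (A.add a b).elemOps = 0)
    (hadd : ∀ a b, 1 ≤ (A.add a b).treeOps) (xs : List L) (T : Tensor L R) :
    (sumLabels A xs T).elemOps ≤ (sumLabels A xs T).treeOps := by
  induction xs generalizing T with
  | nil => simp [sumLabels, Timed.ret]
  | cons x xs ih =>
    simp only [sumLabels, Timed.bind]
    refine Nat.add_le_add ?_ (ih _)
    simp only [sumLabel, tabulate, Timed.tickElem]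
    exact Finset.sum_le_sum fun a _ => by rw [hadd0]; exact hadd _ _

lemma contract_elemOps_le_treeOps {A : ElementType R} (hadd0 : ∀ a b, (A.add a b).elemOps = 0)
    (hmul0 : ∀ a b, (A.mul a b).elemOps = 0) (hadd : ∀ a b, 1 ≤ (A.add a b).treeOps)
    (hmul : ∀ a b, 1 ≤ (A.mul a b).treeOps) (N : TensorNetwork ι L R) (t : ContractionTree ι) :
    (contract A N t).elemOps ≤ (contract A N t).treeOps := by
  induction t with
  | leaf i => exact sumLabels_elemOps_le_treeOps hadd0 hadd _ _
  | node l r ihl ihr =>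
    simp only [contract, Timed.bind]
    refine Nat.add_le_add ihl (Nat.add_le_add ihr
      (Nat.add_le_add ?_ (sumLabels_elemOps_le_treeOps hadd0 hadd _ _)))
    simp only [mulTensor, tabulate, Timed.tickElem]
    exact Finset.sum_le_sum fun a _ => by rw [hmul0]; exact hmul _ _

end OpCount

lemma exists_leaves_eq {ι : Type*} (i : ι) (l : List ι) :
    ∃ T : ContractionTree ι, T.leaves = i :: l := by
  induction l generalizing i with
  | nil => exact ⟨.leaf i, rfl⟩
  | cons j l ih =>
    obtain ⟨T, hT⟩ := ih j
    exact ⟨.node (.leaf i) T, by simp [ContractionTree.leaves, hT]⟩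

lemma exists_isOrder (ι : Type*) [Fintype ι] [Nonempty ι] :
    ∃ T : ContractionTree ι, T.IsOrder := by
  have hne : (Finset.univ : Finset ι).toList ≠ [] := by
    simpa using Finset.univ_nonempty.ne_empty
  obtain ⟨i, l, hl⟩ := List.exists_cons_of_ne_nil hne
  obtain ⟨T, hT⟩ := exists_leaves_eq i l
  refine ⟨T, ?_, fun j => ?_⟩
  · rw [hT, ← hl]
    exact Finset.nodup_toList _
  · rw [hT, ← hl]
    simp

lemma exists_opCount_eq_contractionComplexity {ι L : Type*} [Fintype ι] [DecidableEq ι]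
    [Nonempty ι] [Fintype L] [DecidableEq L] (labels : ι → Finset L) :
    ∃ T : ContractionTree ι, T.IsOrder ∧ T.opCount labels = contractionComplexity labels := by
  obtain ⟨T, hT⟩ := exists_isOrder ι
  exact Nat.sInf_mem (s := {n | ∃ T : ContractionTree ι, T.IsOrder ∧ T.opCount labels = n})
    ⟨_, T, hT, rfl⟩

end SumProductSampling
-- Bit strings as vertex sets.
namespace SumProductSampling

section Bits

variable {V : Type*} [Fintype V]

/-- The bit string of a set of vertices. -/
def bits [DecidableEq V] (s : Finset V) : BitString V := fun v => decide (v ∈ s)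

lemma mem_support {σ : BitString V} {v : V} : v ∈ σ.support ↔ σ v = true := by
  simp [BitString.support]

lemma support_injective : Function.Injective (BitString.support : BitString V → Finset V) := by
  intro σ τ h
  funext v
  have := congrArg (v ∈ ·) h
  simp only [mem_support, eq_iff_iff] at this
  exact Bool.eq_iff_iff.mpr this

lemma support_bits [DecidableEq V] (s : Finset V) : (bits s).support = s := by
  ext v
  simp [mem_support, bits]

lemma bits_support [DecidableEq V] (σ : BitString V) : bits σ.support = σ :=
  support_injective (support_bits _)

lemma support_bitOr [DecidableEq V] (σ τ : BitString V) :
    (bitOr σ τ).support = σ.support ∪ τ.support := by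
  ext v
  simp [mem_support, bitOr]

lemma bitOr_bits [DecidableEq V] (s t : Finset V) : bitOr (bits s) (bits t) = bits (s ∪ t) :=
  support_injective (by simp only [support_bitOr, support_bits])

lemma support_zeroBits : (zeroBits V).support = ∅ := by
  ext v
  simp [mem_support, zeroBits]

lemma support_unitBits [DecidableEq V] (v : V) : (unitBits v).support = {v} := by
  ext u
  simp [mem_support, unitBits]

lemma bitOr_inj [DecidableEq V] {X Y : Finset V} (hXY : Disjoint X Y)
    {σ τ σ' τ' : BitString V} (hσ : σ.support ⊆ X) (hτ : τ.support ⊆ Y) (hσ' : σ'.support ⊆ X)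
    (hτ' : τ'.support ⊆ Y) (h : bitOr σ τ = bitOr σ' τ') : σ = σ' ∧ τ = τ' := by
  have h' := congrArg BitString.support h
  rw [support_bitOr, support_bitOr] at h'
  have key : ∀ v, (v ∈ σ.support ↔ v ∈ σ'.support) ∧ (v ∈ τ.support ↔ v ∈ τ'.support) := by
    intro v
    have h1 := congrArg (v ∈ ·) h'
    simp only [Finset.mem_union, eq_iff_iff] at h1
    have h2 := @hσ v
    have h3 := @hσ' v
    have h4 := @hτ v
    have h5 := @hτ' v
    have h6 : v ∈ X → v ∉ Y := fun h => Finset.disjoint_left.mp hXY h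
    tauto
  exact ⟨support_injective (Finset.ext fun v => (key v).1),
    support_injective (Finset.ext fun v => (key v).2)⟩

lemma card_le_two_pow_of_support_subset {S : Finset (BitString V)} {W : Finset V}
    (h : ∀ σ ∈ S, σ.support ⊆ W) : S.card ≤ 2 ^ W.card := by
  rw [← Finset.card_powerset]
  exact Finset.card_le_card_of_injOn BitString.support
    (fun σ hσ => Finset.mem_powerset.mpr (h σ hσ)) support_injective.injOn

end Bits

/-- `Rep r S W c` says that the tensor element `r` represents the set `S` of bit strings supported
in `W`, with sampling cost at most `c`; these are the closure properties that make it compatible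
with the contraction of a network. -/
structure IsSemantics {V R : Type*} [Fintype V] [DecidableEq V] (A : ElementType R)
    (Rep : R → Finset (BitString V) → Finset V → ℕ → Prop) : Prop where
  zero : ∀ W, Rep A.zero ∅ W (Fintype.card V + 1)
  one : ∀ W, Rep A.one {zeroBits V} W (Fintype.card V + 1)
  add : ∀ {a b S T W c}, Rep a S W c → Rep b T W c → Disjoint S T →
    Rep (A.add a b).val (S ∪ T) W (c + (3 * Fintype.card V + 4))
  mul : ∀ {a b S T X Y c d}, Rep a S X c → Rep b T Y d → Disjoint X Y →
    Rep (A.mul a b).val (Finset.image₂ bitOr S T) (X ∪ Y)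
      (c + d + (Fintype.card V + 1) + 10 * (X.card * Y.card))

/-! ### The sets of strings carried by the subtrees, and the cost of a descent. -/

section Family

variable {V : Type*} [Fintype V] [LinearOrder V] (G : SimpleGraph V) [DecidableRel G.Adj]

open Classical in
/-- The vertices whose tensors are below `t`. -/
noncomputable def vertexLeaves (t : ContractionTree (V ⊕ G.edgeSet)) : Finset V :=
  Finset.univ.filter fun v => Sum.inl v ∈ t.leaves

/-- No edge whose tensor is below `t` lies in `s`. -/
def AvoidsEdges (t : ContractionTree (V ⊕ G.edgeSet)) (s : Finset V) : Prop :=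
  ∀ e : G.edgeSet, Sum.inr e ∈ t.leaves → ¬ (e : Sym2 V).toFinset ⊆ s

open Classical in
/-- The bit strings that contribute to the entry at `a` of the tensor belonging to `t`, while the
labels `X` have not been summed over. -/
noncomputable def partialStrings (t : ContractionTree (V ⊕ G.edgeSet)) (X a : Finset V) :
    Finset (BitString V) :=
  (Finset.univ.filter fun s : Finset V => s ∩ X = a ∧ AvoidsEdges G t s).image
    fun s => bits (s ∩ vertexLeaves G t)

variable {G}

lemma mem_partialStrings {t : ContractionTree (V ⊕ G.edgeSet)} {X a : Finset V}
    {σ : BitString V} : σ ∈ partialStrings G t X a ↔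
      ∃ s : Finset V, (s ∩ X = a ∧ AvoidsEdges G t s) ∧ bits (s ∩ vertexLeaves G t) = σ := by
  simp [partialStrings]

lemma mem_vertexLeaves {t : ContractionTree (V ⊕ G.edgeSet)} {v : V} :
    v ∈ vertexLeaves G t ↔ Sum.inl v ∈ t.leaves := by
  simp [vertexLeaves]

lemma vertexLeaves_node (l r : ContractionTree (V ⊕ G.edgeSet)) :
    vertexLeaves G (.node l r) = vertexLeaves G l ∪ vertexLeaves G r := by
  ext v
  simp [mem_vertexLeaves, ContractionTree.leaves]

lemma vertexLeaves_disjoint {l r : ContractionTree (V ⊕ G.edgeSet)}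
    (h : (ContractionTree.node l r).leaves.Nodup) :
    Disjoint (vertexLeaves G l) (vertexLeaves G r) := by
  rw [ContractionTree.leaves, List.nodup_append] at h
  rw [Finset.disjoint_left]
  intro v hl hr
  exact h.2.2 _ (mem_vertexLeaves.mp hl) _ (mem_vertexLeaves.mp hr) rfl

lemma partialStrings_erase {t : ContractionTree (V ⊕ G.edgeSet)} {X a : Finset V} {x : V}
    (hx : x ∈ X) (ha : a ⊆ X.erase x) :
    partialStrings G t (X.erase x) a =
      partialStrings G t X a ∪ partialStrings G t X (insert x a) := by
  have hxa : x ∉ a := fun h => Finset.notMem_erase x X (ha h)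
  have key : ∀ s : Finset V, s ∩ X.erase x = a ↔ s ∩ X = a ∨ s ∩ X = insert x a := by
    intro s
    have he : s ∩ X.erase x = (s ∩ X).erase x := by
      ext y
      simp only [Finset.mem_inter, Finset.mem_erase]
      tauto
    rw [he]
    constructor
    · intro h
      by_cases hs : x ∈ s
      · right
        rw [← h, Finset.insert_erase (Finset.mem_inter.mpr ⟨hs, hx⟩)]
      · left
        rw [← h, Finset.erase_eq_of_notMem (fun h' => hs (Finset.mem_inter.mp h').1)]
    · rintro (h | h)
      · rw [h, Finset.erase_eq_of_notMem hxa]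
      · rw [h, Finset.erase_insert hxa]
  ext σ
  simp only [Finset.mem_union, mem_partialStrings, key]
  constructor
  · rintro ⟨s, ⟨h | h, h'⟩, hs⟩
    · exact Or.inl ⟨s, ⟨h, h'⟩, hs⟩
    · exact Or.inr ⟨s, ⟨h, h'⟩, hs⟩
  · rintro (⟨s, ⟨h, h'⟩, hs⟩ | ⟨s, ⟨h, h'⟩, hs⟩)
    · exact ⟨s, ⟨Or.inl h, h'⟩, hs⟩
    · exact ⟨s, ⟨Or.inr h, h'⟩, hs⟩

/-- Since the vertex tensor of `x` lies below `t`, the bit at `x` is part of the strings and tells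
the two sets apart. -/
lemma partialStrings_disjoint {t : ContractionTree (V ⊕ G.edgeSet)} {X a : Finset V} {x : V}
    (hx : x ∈ X) (hxt : x ∈ vertexLeaves G t) (hxa : x ∉ a) :
    Disjoint (partialStrings G t X a) (partialStrings G t X (insert x a)) := by
  rw [Finset.disjoint_left]
  intro σ h1 h2
  rw [mem_partialStrings] at h1 h2
  obtain ⟨s, ⟨hs, -⟩, rfl⟩ := h1
  obtain ⟨s', ⟨hs', -⟩, h⟩ := h2
  have h3 := congrArg BitString.support h
  rw [support_bits, support_bits] at h3
  have h4 : x ∈ s' ∩ X := by rw [hs']; exact Finset.mem_insert_self _ _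
  have h5 : x ∈ s' ∩ vertexLeaves G t := Finset.mem_inter.mpr ⟨(Finset.mem_inter.mp h4).1, hxt⟩
  rw [h3] at h5
  exact hxa (hs ▸ Finset.mem_inter.mpr ⟨(Finset.mem_inter.mp h5).1, hx⟩)

/-- Vertex sets chosen for the two subtrees can be glued: a label occurring on both sides is open on
both sides, because no tensor is shared, and there both choices are prescribed by `a`. -/
lemma partialStrings_node {l r : ContractionTree (V ⊕ G.edgeSet)}
    (hnd : (ContractionTree.node l r).leaves.Nodup) {a : Finset V}
    (ha : a ⊆ l.openLabels (misLabels G) ∪ r.openLabels (misLabels G)) :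
    partialStrings G (.node l r) (l.openLabels (misLabels G) ∪ r.openLabels (misLabels G)) a =
      Finset.image₂ bitOr
        (partialStrings G l (l.openLabels (misLabels G)) (a ∩ l.openLabels (misLabels G)))
        (partialStrings G r (r.openLabels (misLabels G)) (a ∩ r.openLabels (misLabels G))) := by
  have hdis : ∀ i, i ∈ l.leaves → i ∉ r.leaves := fun i hl hr => by
    rw [ContractionTree.leaves, List.nodup_append] at hnd
    exact hnd.2.2 i hl i hr rfl
  ext σ
  rw [Finset.mem_image₂]
  simp only [mem_partialStrings]
  constructor
  · rintro ⟨s, ⟨hs, hav⟩, rfl⟩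
    refine ⟨_, ⟨s, ⟨?_, fun e he => hav e ?_⟩, rfl⟩, _, ⟨s, ⟨?_, fun e he => hav e ?_⟩, rfl⟩, ?_⟩
    · rw [← hs, Finset.inter_assoc, Finset.union_inter_cancel_left]
    · simp [ContractionTree.leaves, he]
    · rw [← hs, Finset.inter_assoc, Finset.union_inter_cancel_right]
    · simp [ContractionTree.leaves, he]
    · rw [bitOr_bits, vertexLeaves_node, Finset.inter_union_distrib_left]
  · rintro ⟨_, ⟨s₁, ⟨hs₁, hav₁⟩, rfl⟩, _, ⟨s₂, ⟨hs₂, hav₂⟩, rfl⟩, rfl⟩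
    classical
    let lab : Finset V := Finset.univ.filter fun x => ∃ i ∈ l.leaves, x ∈ misLabels G i
    have hlab : ∀ x, x ∈ lab ↔ ∃ i ∈ l.leaves, x ∈ misLabels G i := fun x => by simp [lab]
    -- The glued set follows `s₁` on the labels of `l` and `s₂` elsewhere; it thus agrees with `s₂`
    -- on all labels of `r` as well.
    let s : Finset V := Finset.univ.filter fun x => if x ∈ lab then x ∈ s₁ else x ∈ s₂
    have hmem₁ : ∀ x, (∃ i ∈ l.leaves, x ∈ misLabels G i) → (x ∈ s ↔ x ∈ s₁) := fun x hx => by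
      simp [s, (hlab x).mpr hx]
    have hmem₂ : ∀ x, (∃ i ∈ r.leaves, x ∈ misLabels G i) → (x ∈ s ↔ x ∈ s₂) := by
      rintro x ⟨j, hj, hxj⟩
      by_cases hx : x ∈ lab
      · obtain ⟨i, hi, hxi⟩ := (hlab x).mp hx
        rw [hmem₁ x ⟨i, hi, hxi⟩]
        have hol : x ∈ l.openLabels (misLabels G) :=
          mem_openLabels.mpr ⟨⟨i, hi, hxi⟩, j, fun h => hdis j h hj, hxj⟩
        have hor : x ∈ r.openLabels (misLabels G) :=
          mem_openLabels.mpr ⟨⟨j, hj, hxj⟩, i, hdis i hi, hxi⟩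
        have e1 := congrArg (x ∈ ·) hs₁
        have e2 := congrArg (x ∈ ·) hs₂
        simp only [Finset.mem_inter, hol, hor, and_true, eq_iff_iff] at e1 e2
        rw [e1, e2]
      · simp [s, hx]
    refine ⟨s, ⟨?_, ?_⟩, ?_⟩
    · ext x
      rw [Finset.mem_inter, Finset.mem_union]
      constructor
      · rintro ⟨hx, h | h⟩
        · rw [hmem₁ x (mem_openLabels.mp h).1] at hx
          exact (Finset.mem_inter.mp (hs₁ ▸ Finset.mem_inter.mpr ⟨hx, h⟩)).1
        · rw [hmem₂ x (mem_openLabels.mp h).1] at hx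
          exact (Finset.mem_inter.mp (hs₂ ▸ Finset.mem_inter.mpr ⟨hx, h⟩)).1
      · intro hx
        rcases Finset.mem_union.mp (ha hx) with h | h
        · refine ⟨(hmem₁ x (mem_openLabels.mp h).1).mpr ?_, Or.inl h⟩
          exact (Finset.mem_inter.mp (hs₁.symm ▸ Finset.mem_inter.mpr ⟨hx, h⟩ : x ∈ s₁ ∩ _)).1
        · refine ⟨(hmem₂ x (mem_openLabels.mp h).1).mpr ?_, Or.inr h⟩
          exact (Finset.mem_inter.mp (hs₂.symm ▸ Finset.mem_inter.mpr ⟨hx, h⟩ : x ∈ s₂ ∩ _)).1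
    · intro e he hes
      rw [ContractionTree.leaves, List.mem_append] at he
      rcases he with he | he
      · exact hav₁ e he fun x hx => (hmem₁ x ⟨_, he, hx⟩).mp (hes hx)
      · exact hav₂ e he fun x hx => (hmem₂ x ⟨_, he, hx⟩).mp (hes hx)
    · rw [bitOr_bits]
      congr 1
      ext x
      simp only [Finset.mem_inter, Finset.mem_union, mem_vertexLeaves, ContractionTree.leaves,
        List.mem_append]
      have e1 : Sum.inl x ∈ l.leaves → (x ∈ s ↔ x ∈ s₁) := fun h =>
        hmem₁ x ⟨_, h, by simp [misLabels]⟩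
      have e2 : Sum.inl x ∈ r.leaves → (x ∈ s ↔ x ∈ s₂) := fun h =>
        hmem₂ x ⟨_, h, by simp [misLabels]⟩
      tauto

variable (G)

/-- A bound for the cost of a sample from the entries of the tensor that belongs to `t`. -/
noncomputable def costBound : ContractionTree (V ⊕ G.edgeSet) → ℕ
  | .leaf i => Fintype.card V + 1 +
      (misLabels G i \ (ContractionTree.leaf i).openLabels (misLabels G)).card *
        (3 * Fintype.card V + 4)
  | .node l r => costBound l + costBound r + (Fintype.card V + 1) +
      10 * ((vertexLeaves G l).card * (vertexLeaves G r).card) +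
      ((l.openLabels (misLabels G) ∪ r.openLabels (misLabels G)) \
        (ContractionTree.node l r).openLabels (misLabels G)).card * (3 * Fintype.card V + 4)

/-- The labels that occur only in tensors below `t`, and in at least one. -/
def closedLabels (t : ContractionTree (V ⊕ G.edgeSet)) : Finset V :=
  Finset.univ.filter fun x =>
    (∃ i, i ∈ t.leaves ∧ x ∈ misLabels G i) ∧ x ∉ t.openLabels (misLabels G)

variable {G}

lemma mem_closedLabels {t : ContractionTree (V ⊕ G.edgeSet)} {x : V} :
    x ∈ closedLabels G t ↔
      (∃ i, i ∈ t.leaves ∧ x ∈ misLabels G i) ∧ ∀ j, x ∈ misLabels G j → j ∈ t.leaves := by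
  simp only [closedLabels, Finset.mem_filter_univ, mem_openLabels]
  constructor
  · rintro ⟨h1, h2⟩
    exact ⟨h1, fun j hj => by_contra fun h => h2 ⟨h1, j, h, hj⟩⟩
  · rintro ⟨h1, h2⟩
    exact ⟨h1, fun ⟨_, j, h, hj⟩ => h (h2 j hj)⟩

lemma closedLabels_subset_vertexLeaves (t : ContractionTree (V ⊕ G.edgeSet)) :
    closedLabels G t ⊆ vertexLeaves G t := fun x hx =>
  mem_vertexLeaves.mpr ((mem_closedLabels.mp hx).2 _ (by simp [misLabels]))

lemma sdiff_openLabels_subset_closedLabels {l r : ContractionTree (V ⊕ G.edgeSet)} :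
    (l.openLabels (misLabels G) ∪ r.openLabels (misLabels G)) \
        (ContractionTree.node l r).openLabels (misLabels G) ⊆ closedLabels G (.node l r) := by
  intro x hx
  rw [Finset.mem_sdiff, Finset.mem_union] at hx
  rw [closedLabels, Finset.mem_filter_univ]
  refine ⟨?_, hx.2⟩
  rcases hx.1 with h | h
  · obtain ⟨i, hi, hxi⟩ := (mem_openLabels.mp h).1
    exact ⟨i, by simp [ContractionTree.leaves, hi], hxi⟩
  · obtain ⟨i, hi, hxi⟩ := (mem_openLabels.mp h).1
    exact ⟨i, by simp [ContractionTree.leaves, hi], hxi⟩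

/-- Labels closed in different subtrees differ, since each has its vertex tensor in its own subtree;
a label summed at the node was open in a child and cannot have been closed earlier. This makes the
total number of summations at most `|V|`. -/
lemma card_closedLabels_node {l r : ContractionTree (V ⊕ G.edgeSet)}
    (hnd : (ContractionTree.node l r).leaves.Nodup) :
    (closedLabels G l).card + (closedLabels G r).card +
      ((l.openLabels (misLabels G) ∪ r.openLabels (misLabels G)) \
        (ContractionTree.node l r).openLabels (misLabels G)).card ≤
      (closedLabels G (.node l r)).card := by
  have h1 : Disjoint (closedLabels G l) (closedLabels G r) :=
    (vertexLeaves_disjoint hnd).mono (closedLabels_subset_vertexLeaves l)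
      (closedLabels_subset_vertexLeaves r)
  have hl : closedLabels G l ⊆ closedLabels G (.node l r) := fun x hx => by
    rw [mem_closedLabels] at hx ⊢
    obtain ⟨⟨i, hi, hxi⟩, h⟩ := hx
    exact ⟨⟨i, by simp [ContractionTree.leaves, hi], hxi⟩, fun j hj => by
      simp [ContractionTree.leaves, h j hj]⟩
  have hr : closedLabels G r ⊆ closedLabels G (.node l r) := fun x hx => by
    rw [mem_closedLabels] at hx ⊢
    obtain ⟨⟨i, hi, hxi⟩, h⟩ := hx
    exact ⟨⟨i, by simp [ContractionTree.leaves, hi], hxi⟩, fun j hj => by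
      simp [ContractionTree.leaves, h j hj]⟩
  have h2 : Disjoint (closedLabels G l ∪ closedLabels G r)
      ((l.openLabels (misLabels G) ∪ r.openLabels (misLabels G)) \
        (ContractionTree.node l r).openLabels (misLabels G)) := by
    rw [ContractionTree.leaves, List.nodup_append] at hnd
    rw [Finset.disjoint_left]
    intro x hx hx'
    rw [Finset.mem_union, mem_closedLabels, mem_closedLabels] at hx
    rw [Finset.mem_sdiff, Finset.mem_union, mem_openLabels, mem_openLabels] at hx'
    rcases hx with ⟨⟨i, hi, hxi⟩, h⟩ | ⟨⟨i, hi, hxi⟩, h⟩ <;>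
      rcases hx'.1 with ⟨⟨j, hj, hxj⟩, k, hk, hxk⟩ | ⟨⟨j, hj, hxj⟩, k, hk, hxk⟩
    · exact hk (h k hxk)
    · exact hnd.2.2 j (h j hxj) j hj rfl
    · exact hnd.2.2 j hj j (h j hxj) rfl
    · exact hk (h k hxk)
  rw [← Finset.card_union_of_disjoint h1, ← Finset.card_union_of_disjoint h2]
  exact Finset.card_le_card
    (Finset.union_subset (Finset.union_subset hl hr) sdiff_openLabels_subset_closedLabels)

/-- A tree with `m` leaves has `m - 1` inner nodes, so the terms `|V| + 1` occur `2 * m - 1` times;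
the extra one on the left makes the bound additive. The convolution terms telescope by `5 * (x + y)
^ 2 = 5 * x ^ 2 + 5 * y ^ 2 + 10 * (x * y)`. -/
lemma costBound_le {t : ContractionTree (V ⊕ G.edgeSet)} (hnd : t.leaves.Nodup) :
    costBound G t + (Fintype.card V + 1) ≤ 2 * t.leaves.length * (Fintype.card V + 1) +
      5 * (vertexLeaves G t).card ^ 2 + (closedLabels G t).card * (3 * Fintype.card V + 4) := by
  induction t with
  | leaf i =>
    have : misLabels G i \ (ContractionTree.leaf i).openLabels (misLabels G) ⊆
        closedLabels G (.leaf i) := by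
      intro x hx
      rw [Finset.mem_sdiff] at hx
      rw [closedLabels, Finset.mem_filter_univ]
      exact ⟨⟨i, by simp [ContractionTree.leaves], hx.1⟩, hx.2⟩
    have := Nat.mul_le_mul_right (3 * Fintype.card V + 4) (Finset.card_le_card this)
    simp only [costBound, ContractionTree.leaves, List.length_singleton]
    nlinarith [Nat.zero_le ((vertexLeaves G (.leaf i)).card ^ 2)]
  | node l r ihl ihr =>
    have hnd' := hnd
    rw [ContractionTree.leaves, List.nodup_append] at hnd'
    have h1 := ihl hnd'.1
    have h2 := ihr hnd'.2.1
    have h3 := Nat.mul_le_mul_right (3 * Fintype.card V + 4) (card_closedLabels_node hnd)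
    rw [vertexLeaves_node, Finset.card_union_of_disjoint (vertexLeaves_disjoint hnd)]
    simp only [costBound, ContractionTree.leaves, List.length_append]
    linarith

lemma rep_sumLabels {R : Type*} {A : ElementType R}
    {Rep : R → Finset (BitString V) → Finset V → ℕ → Prop} (h : IsSemantics A Rep)
    (t : ContractionTree (V ⊕ G.edgeSet)) (xs : List V) (T : Tensor V R) (c : ℕ)
    (hnd : xs.Nodup) (hxs : ∀ x ∈ xs, x ∈ T.labels) (hxt : ∀ x ∈ xs, x ∈ vertexLeaves G t)
    (hT : ∀ a ⊆ T.labels, Rep (T.entry a) (partialStrings G t T.labels a) (vertexLeaves G t) c) :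
    ∀ a ⊆ T.labels \ xs.toFinset, Rep ((sumLabels A xs T).val.entry a)
      (partialStrings G t (T.labels \ xs.toFinset) a) (vertexLeaves G t)
      (c + xs.length * (3 * Fintype.card V + 4)) := by
  induction xs generalizing T c with
  | nil => simpa [sumLabels, Timed.ret] using hT
  | cons x xs ih =>
    have hx : x ∈ T.labels := hxs x (by simp)
    have hnd' := List.nodup_cons.mp hnd
    have h1 : T.labels.erase x \ xs.toFinset = T.labels \ (x :: xs).toFinset := by
      ext y
      simp
      tauto
    have key := ih (sumLabel A T x).val (c + (3 * Fintype.card V + 4)) hnd'.2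
      (fun y hy => Finset.mem_erase.mpr ⟨fun h => hnd'.1 (h ▸ hy), hxs y (by simp [hy])⟩)
      (fun y hy => hxt y (by simp [hy])) (by
        intro a ha
        change a ⊆ T.labels.erase x at ha
        change Rep _ (partialStrings G t (T.labels.erase x) a) _ _
        have ha' : a ⊆ T.labels := ha.trans (Finset.erase_subset _ _)
        rw [partialStrings_erase hx ha]
        exact h.add (hT a ha') (hT _ (Finset.insert_subset hx ha'))
          (partialStrings_disjoint hx (hxt x (by simp))
            fun h => Finset.notMem_erase x _ (ha h)))
    change ∀ a ⊆ T.labels.erase x \ xs.toFinset, Rep _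
      (partialStrings G t (T.labels.erase x \ xs.toFinset) a) _ _ at key
    rw [h1] at key
    intro a ha
    have := key a ha
    rw [List.length_cons, Nat.succ_mul, Nat.add_comm (xs.length * _), ← Nat.add_assoc]
    exact this

/-- Below a vertex leaf the only visible bit is the one at that vertex, fixed by `a`. Below an edge
leaf no bit is visible, so all admissible vertex sets collapse to the zero string, and there is none
exactly when `a` contains the whole edge. -/
lemma rep_leaf {R : Type*} {A : ElementType R}
    {Rep : R → Finset (BitString V) → Finset V → ℕ → Prop} (h : IsSemantics A Rep)
    {x : V → R} (hx : ∀ v, Rep (x v) {unitBits v} {v} (Fintype.card V + 1))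
    (i : V ⊕ G.edgeSet) (a : Finset V) (ha : a ⊆ misLabels G i) :
    Rep ((misNetwork G A x).entry i a) (partialStrings G (.leaf i) (misLabels G i) a)
      (vertexLeaves G (.leaf i)) (Fintype.card V + 1) := by
  rcases i with v | e
  · have hW : vertexLeaves G (.leaf (Sum.inl v)) = {v} := by
      ext u
      simp [mem_vertexLeaves, ContractionTree.leaves]
    have hS : partialStrings G (.leaf (Sum.inl v)) (misLabels G (Sum.inl v)) a = {bits a} := by
      ext σ
      rw [mem_partialStrings, hW, Finset.mem_singleton]
      change a ⊆ {v} at ha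
      constructor
      · rintro ⟨s, ⟨hs, -⟩, rfl⟩
        change s ∩ {v} = a at hs
        rw [hs]
      · rintro rfl
        refine ⟨a, ⟨Finset.inter_eq_left.mpr ha, ?_⟩, by rw [Finset.inter_eq_left.mpr ha]⟩
        intro e he
        simp [ContractionTree.leaves] at he
    rw [hS, hW]
    change Rep (if v ∈ a then x v else A.one) _ _ _
    rcases Finset.subset_singleton_iff.mp ha with rfl | rfl
    · have : bits (∅ : Finset V) = zeroBits V :=
        support_injective (by rw [support_bits, support_zeroBits])
      rw [if_neg (Finset.notMem_empty v), this]
      exact h.one _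
    · have : bits ({v} : Finset V) = unitBits v :=
        support_injective (by rw [support_bits, support_unitBits])
      rw [if_pos (Finset.mem_singleton_self v), this]
      exact hx v
  · have hW : vertexLeaves G (.leaf (Sum.inr e)) = ∅ := by
      ext u
      simp [mem_vertexLeaves, ContractionTree.leaves]
    change Rep (if (e : Sym2 V).toFinset ⊆ a then A.zero else A.one) _ _ _
    change a ⊆ (e : Sym2 V).toFinset at ha
    have hS : partialStrings G (.leaf (Sum.inr e)) (misLabels G (Sum.inr e)) a =
        if (e : Sym2 V).toFinset ⊆ a then ∅ else {zeroBits V} := by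
      have h0 : bits (∅ : Finset V) = zeroBits V :=
        support_injective (by rw [support_bits, support_zeroBits])
      ext σ
      rw [mem_partialStrings, hW]
      simp only [Finset.inter_empty, h0]
      split_ifs with hea
      · simp only [Finset.notMem_empty, iff_false]
        rintro ⟨s, ⟨hs, hav⟩, -⟩
        refine hav e (by simp [ContractionTree.leaves]) (hea.trans ?_)
        rw [← hs]
        exact Finset.inter_subset_left
      · rw [Finset.mem_singleton]
        constructor
        · rintro ⟨-, -, rfl⟩
          rfl
        · rintro rfl
          refine ⟨a, ⟨Finset.inter_eq_left.mpr ha, fun e' he' => ?_⟩, rfl⟩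
          simp only [ContractionTree.leaves, List.mem_singleton, Sum.inr.injEq] at he'
          rwa [he']
    rw [hS]
    split_ifs
    · exact h.zero _
    · exact h.one _

/-- The core induction: a product node is handled by `partialStrings_node`, the summations after it
by `rep_sumLabels`. Distinctness of the leaves provides the disjoint vertex sets that
`IsSemantics.mul` demands. -/
theorem rep_contract {R : Type*} {A : ElementType R}
    {Rep : R → Finset (BitString V) → Finset V → ℕ → Prop} (h : IsSemantics A Rep)
    {x : V → R} (hx : ∀ v, Rep (x v) {unitBits v} {v} (Fintype.card V + 1))
    (t : ContractionTree (V ⊕ G.edgeSet)) (hnd : t.leaves.Nodup) :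
    ∀ a ⊆ t.openLabels (misLabels G), Rep ((contract A (misNetwork G A x) t).val.entry a)
      (partialStrings G t (t.openLabels (misLabels G)) a) (vertexLeaves G t) (costBound G t) := by
  induction t with
  | leaf i =>
    have hsub := openLabels_leaf_subset (misLabels G) i
    have key := rep_sumLabels h (.leaf i)
      ((misLabels G i \ (ContractionTree.leaf i).openLabels (misLabels G)).sort (· ≤ ·))
      ⟨misLabels G i, (misNetwork G A x).entry i⟩ (Fintype.card V + 1) (Finset.sort_nodup _ _)
      (fun y hy => (Finset.mem_sdiff.mp ((Finset.mem_sort _).mp hy)).1)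
      (fun y hy => by
        rw [Finset.mem_sort, Finset.mem_sdiff] at hy
        refine closedLabels_subset_vertexLeaves _ ?_
        rw [closedLabels, Finset.mem_filter_univ]
        exact ⟨⟨i, by simp [ContractionTree.leaves], hy.1⟩, hy.2⟩)
      (fun a ha => rep_leaf h hx i a ha)
    simp only [Finset.sort_toFinset, Finset.sdiff_sdiff_eq_self hsub, Finset.length_sort] at key
    exact key
  | node l r ihl ihr =>
    have hnd' := hnd
    rw [ContractionTree.leaves, List.nodup_append] at hnd'
    have hl := ihl hnd'.1
    have hr := ihr hnd'.2.1
    have hsub := openLabels_node_subset (misLabels G) l r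
    set S := (contract A (misNetwork G A x) l).val with hS
    set T := (contract A (misNetwork G A x) r).val with hT
    have hSl : S.labels = l.openLabels (misLabels G) := contract_labels A (misNetwork G A x) l
    have hTl : T.labels = r.openLabels (misLabels G) := contract_labels A (misNetwork G A x) r
    have hP : (mulTensor A S T).val.labels =
        l.openLabels (misLabels G) ∪ r.openLabels (misLabels G) := by
      rw [← hSl, ← hTl]
      rfl
    have key := rep_sumLabels h (.node l r)
      (((mulTensor A S T).val.labels \
        (ContractionTree.node l r).openLabels (misLabels G)).sort (· ≤ ·))
      (mulTensor A S T).val (costBound G l + costBound G r + (Fintype.card V + 1) +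
        10 * ((vertexLeaves G l).card * (vertexLeaves G r).card)) (Finset.sort_nodup _ _)
      (fun y hy => (Finset.mem_sdiff.mp ((Finset.mem_sort _).mp hy)).1)
      (fun y hy => by
        rw [Finset.mem_sort, hP] at hy
        exact closedLabels_subset_vertexLeaves _ (sdiff_openLabels_subset_closedLabels hy))
      (fun a ha => by
        rw [hP] at ha ⊢
        rw [partialStrings_node hnd ha, vertexLeaves_node]
        change Rep (A.mul (S.entry (a ∩ S.labels)) (T.entry (a ∩ T.labels))).val _ _ _
        rw [hSl, hTl]
        exact h.mul (hl _ Finset.inter_subset_right) (hr _ Finset.inter_subset_right)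
          (vertexLeaves_disjoint hnd))
    have hcard := congrArg
      (fun X => (X \ (ContractionTree.node l r).openLabels (misLabels G)).card) hP
    rw [← hP] at hsub
    rw [Finset.sort_toFinset, Finset.length_sort, Finset.sdiff_sdiff_eq_self hsub, hcard] at key
    exact key

lemma openLabels_of_isOrder {t : ContractionTree (V ⊕ G.edgeSet)} (ht : t.IsOrder) :
    t.openLabels (misLabels G) = ∅ := by
  rw [Finset.eq_empty_iff_forall_notMem]
  intro x hx
  obtain ⟨-, j, hj, -⟩ := mem_openLabels.mp hx
  exact hj (ht.2 j)

lemma partialStrings_of_isOrder {t : ContractionTree (V ⊕ G.edgeSet)} (ht : t.IsOrder) :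
    partialStrings G t ∅ ∅ = indepStrings G := by
  have hW : vertexLeaves G t = Finset.univ := by
    ext v
    simp [mem_vertexLeaves, ht.2]
  have hav : ∀ s : Finset V, AvoidsEdges G t s ↔ G.IsIndepSet (s : Set V) := by
    intro s
    constructor
    · intro h u hu v hv _ huv
      refine h ⟨s(u, v), huv⟩ (ht.2 _) fun x hx => ?_
      rw [Sym2.mem_toFinset, Sym2.mem_iff] at hx
      rcases hx with rfl | rfl
      · exact hu
      · exact hv
    · rintro h ⟨e, he⟩ - hes
      induction e using Sym2.ind with
      | _ u v =>
        have hu : u ∈ s := hes (by simp [Sym2.mem_toFinset])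
        have hv : v ∈ s := hes (by simp [Sym2.mem_toFinset])
        exact h hu hv (G.ne_of_adj he) he
  ext σ
  rw [mem_partialStrings, hW]
  simp only [hav, Finset.inter_empty, Finset.inter_univ, true_and, indepStrings,
    Finset.mem_filter_univ]
  constructor
  · rintro ⟨s, hs, rfl⟩
    rwa [support_bits]
  · intro h
    exact ⟨_, h, bits_support σ⟩

lemma length_leaves_of_isOrder {t : ContractionTree (V ⊕ G.edgeSet)} (ht : t.IsOrder) :
    t.leaves.length = Fintype.card V + G.edgeFinset.card := by
  rw [← List.toFinset_card_of_nodup ht.1, SimpleGraph.edgeFinset_card, ← Fintype.card_sum,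
    ← Finset.card_univ]
  congr 1
  ext i
  simp [ht.2]

lemma costBound_le_of_isOrder [Nonempty V] {t : ContractionTree (V ⊕ G.edgeSet)}
    (ht : t.IsOrder) : costBound G t + Fintype.card V * (3 * Fintype.card V + 4) ≤
      23 * (Fintype.card V * (Fintype.card V + G.edgeFinset.card)) := by
  have h := costBound_le ht.1
  rw [length_leaves_of_isOrder ht] at h
  have h1 := Nat.pow_le_pow_left (Finset.card_le_univ (vertexLeaves G t)) 2
  have h2 := Nat.mul_le_mul_right (3 * Fintype.card V + 4) (Finset.card_le_univ (closedLabels G t))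
  have h3 : 1 ≤ Fintype.card V := Fintype.card_pos
  -- By `|V| ≥ 1`, the node costs are at most `4 |V| (|V| + |E|)`, the convolutions `5 |V|²`, and
  -- the label summations and the final join `7 |V|²` each: `4 + 5 + 7 + 7 = 23`.
  nlinarith [Nat.zero_le (G.edgeFinset.card * (Fintype.card V - 1)),
    Nat.mul_le_mul_left G.edgeFinset.card h3, Nat.mul_le_mul_left (Fintype.card V) h3]

theorem rep_contractScalar {R : Type*} {A : ElementType R}
    {Rep : R → Finset (BitString V) → Finset V → ℕ → Prop} (h : IsSemantics A Rep)
    {x : V → R} (hx : ∀ v, Rep (x v) {unitBits v} {v} (Fintype.card V + 1))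
    {t : ContractionTree (V ⊕ G.edgeSet)} (ht : t.IsOrder) :
    Rep (contractScalar A (misNetwork G A x) t).val (indepStrings G) (vertexLeaves G t)
      (costBound G t) := by
  have := rep_contract h hx t ht.1 ∅ (Finset.empty_subset _)
  rwa [openLabels_of_isOrder ht, partialStrings_of_isOrder ht] at this

end Family

end SumProductSampling
-- Expression trees as semantics of tensor elements.
namespace SumProductSampling

variable {V : Type*} [Fintype V]

section Tree

/-- The expression tree `e` represents the set `S` of bit strings supported in `W`. -/
def RepTree (e : ExprTree V) (S : Finset (BitString V)) (W : Finset V) (c : ℕ) : Prop :=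
  Samples e S c ∧ ∀ σ ∈ S, σ.support ⊆ W

lemma card_le_two_pow_card (S : Finset (BitString V)) : S.card ≤ 2 ^ Fintype.card V :=
  card_le_two_pow_of_support_subset (W := Finset.univ) fun _ _ => Finset.subset_univ _

lemma support_subset_of_mem_image₂ [DecidableEq V] {S T : Finset (BitString V)} {X Y : Finset V}
    (hS : ∀ σ ∈ S, σ.support ⊆ X) (hT : ∀ σ ∈ T, σ.support ⊆ Y) :
    ∀ σ ∈ Finset.image₂ bitOr S T, σ.support ⊆ X ∪ Y := by
  intro σ hσ
  obtain ⟨x, hx, y, hy, rfl⟩ := Finset.mem_image₂.mp hσ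
  rw [support_bitOr]
  exact Finset.union_subset_union (hS x hx) (hT y hy)

lemma isSemantics_repTree [DecidableEq V] :
    IsSemantics (ExprTree.elements V) (RepTree (V := V)) where
  zero W := ⟨Samples.zero _, by simp⟩
  one W := ⟨Samples.leaf _, by simp [support_zeroBits]⟩
  add h₁ h₂ hd := by
    refine ⟨h₁.1.mkSum h₂.1 hd (card_le_two_pow_card _), fun σ hσ => ?_⟩
    rcases Finset.mem_union.mp hσ with h | h
    · exact h₁.2 σ h
    · exact h₂.2 σ h
  mul h₁ h₂ hd :=
    ⟨(h₁.1.mkProd h₂.1 fun x hx y hy x' hx' y' hy' h =>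
      bitOr_inj hd (h₁.2 x hx) (h₂.2 y hy) (h₁.2 x' hx') (h₂.2 y' hy') h).mono
        (Nat.le_add_right _ _), support_subset_of_mem_image₂ h₁.2 h₂.2⟩

end Tree

/-! ### Truncated polynomials as semantics of tensor elements. -/

section Layer

/-- The bit strings in `S` of size `d - i`. -/
def layer (S : Finset (BitString V)) (d i : ℕ) : Finset (BitString V) :=
  S.filter fun σ => σ.support.card + i = d

lemma mem_layer {S : Finset (BitString V)} {d i : ℕ} {σ : BitString V} :
    σ ∈ layer S d i ↔ σ ∈ S ∧ σ.support.card + i = d := by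
  simp [layer]

lemma layer_union (S T : Finset (BitString V)) (d i : ℕ) :
    layer (S ∪ T) d i = layer S d i ∪ layer T d i := Finset.filter_union _ _ _

lemma layer_subset (S : Finset (BitString V)) (d i : ℕ) : layer S d i ⊆ S :=
  Finset.filter_subset _ _

/-- The truncated polynomial `p` represents the set `S` of bit strings supported in `W`: its
coefficients represent the bit strings of the `K` largest sizes, sorted by size. -/
structure RepPoly (K : ℕ) (p : TruncPoly V) (S : Finset (BitString V)) (W : Finset V) (c : ℕ) :
    Prop where
  support_subset : ∀ σ ∈ S, σ.support ⊆ W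
  coeffs_eq_nil_iff : p.coeffs = [] ↔ S = ∅
  length_le : p.coeffs.length ≤ K
  length_le_order : p.coeffs.length ≤ p.order + 1
  card_le : ∀ σ ∈ S, σ.support.card ≤ p.order
  exists_card : S.Nonempty → ∃ σ ∈ S, σ.support.card = p.order
  coeff : ∀ i < K, Samples (p.coeffs.getD i .zero) (layer S p.order i) c

variable {K : ℕ} {p q : TruncPoly V} {S T : Finset (BitString V)} {W X Y : Finset V} {c d : ℕ}

namespace RepPoly

/-- The order is the size of an actual string supported in `W`, so the number of coefficients is
bounded independently of `K`. -/
lemma length_le_card (h : RepPoly K p S W c) : p.coeffs.length ≤ W.card + 1 := by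
  rcases S.eq_empty_or_nonempty with hS | hS
  · rw [h.coeffs_eq_nil_iff.mpr hS]
    simp
  · obtain ⟨σ, hσ, hc⟩ := h.exists_card hS
    have := Finset.card_le_card (h.support_subset σ hσ)
    have := h.length_le_order
    omega

/-- Past the end of the list the default `ZERO` is read, which represents only the empty layer. -/
lemma lt_length (h : RepPoly K p S W c) {i : ℕ} (hi : i < K)
    (hne : (layer S p.order i).Nonempty) : i < p.coeffs.length := by
  by_contra hlt
  have := h.coeff i hi
  rw [List.getD_eq_default _ _ (not_lt.mp hlt)] at this
  exact hne.ne_empty this.eq_empty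

lemma of_empty (W : Finset V) (c : ℕ) : RepPoly K (⟨0, []⟩ : TruncPoly V) ∅ W c where
  support_subset := by simp
  coeffs_eq_nil_iff := by simp
  length_le := by simp
  length_le_order := by simp
  card_le := by simp
  exists_card := by simp
  coeff i _ := by simpa [layer] using Samples.zero c

lemma of_singleton (hK : 1 ≤ K) {σ : BitString V} (hσ : σ.support ⊆ W) :
    RepPoly K ⟨σ.support.card, [.leaf σ]⟩ {σ} W (Fintype.card V + 1) where
  support_subset := by simpa using hσ
  coeffs_eq_nil_iff := by simp
  length_le := by simpa using hK
  length_le_order := by simp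
  card_le := by simp
  exists_card _ := by simp
  coeff i _ := by
    cases i with
    | zero => simpa [layer, Finset.filter_singleton] using Samples.leaf σ
    | succ i => simpa [layer, Finset.filter_singleton] using Samples.zero _

end RepPoly

lemma addCoeffs_length (as bs : List (ExprTree V)) :
    (TruncPoly.addCoeffs as bs).val.length = max as.length bs.length := by
  induction as generalizing bs with
  | nil => simp [TruncPoly.addCoeffs, Timed.ret]
  | cons a as ih =>
    cases bs with
    | nil => simp [TruncPoly.addCoeffs, Timed.ret]
    | cons b bs => simp [TruncPoly.addCoeffs, Timed.bind, Timed.ret, ih]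

lemma addCoeffs_ops (as bs : List (ExprTree V)) :
    (TruncPoly.addCoeffs as bs).elemOps = 0 ∧
      (TruncPoly.addCoeffs as bs).treeOps ≤ as.length := by
  induction as generalizing bs with
  | nil => simp [TruncPoly.addCoeffs, Timed.ret]
  | cons a as ih =>
    cases bs with
    | nil => simp [TruncPoly.addCoeffs, Timed.ret]
    | cons b bs =>
      obtain ⟨h1, h2⟩ := ih bs
      simp only [TruncPoly.addCoeffs, Timed.bind, Timed.ret, ExprTree.mkSum, Timed.tickTree,
        List.length_cons, h1]
      exact ⟨trivial, by omega⟩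

/-- Where one list has ended, its missing coefficient counts as `ZERO` and the other one is passed
on unchanged. -/
lemma Samples.addCoeffs (hd : Disjoint S T) (as bs : List (ExprTree V)) (i : ℕ)
    (hS : Samples (as.getD i .zero) S c) (hT : Samples (bs.getD i .zero) T c) :
    Samples ((TruncPoly.addCoeffs as bs).val.getD i .zero) (S ∪ T)
      (c + (3 * Fintype.card V + 4)) := by
  induction as generalizing bs i with
  | nil =>
    rw [List.getD_nil] at hS
    rw [hS.eq_empty, Finset.empty_union]
    simpa [TruncPoly.addCoeffs, Timed.ret] using hT.mono (Nat.le_add_right _ _)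
  | cons a as ih =>
    cases bs with
    | nil =>
      rw [List.getD_nil] at hT
      rw [hT.eq_empty, Finset.union_empty]
      simpa [TruncPoly.addCoeffs, Timed.ret] using hS.mono (Nat.le_add_right _ _)
    | cons b bs =>
      cases i with
      | zero =>
        rw [List.getD_cons_zero] at hS hT
        exact hS.mkSum hT hd (card_le_two_pow_card _)
      | succ i =>
        rw [List.getD_cons_succ] at hS hT
        exact ih bs i hS hT

lemma RepPoly.coeff_align (h : RepPoly K p S W c) {D : ℕ} (hD : p.order ≤ D) {i : ℕ}
    (hi : i < K) :
    Samples (((List.replicate (D - p.order) ExprTree.zero ++ p.coeffs).take K).getD i .zero)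
      (layer S D i) c := by
  rw [List.getD_eq_getElem?_getD, List.getElem?_take_of_lt hi, ← List.getD_eq_getElem?_getD]
  by_cases hlt : i < D - p.order
  · have h1 : layer S D i = ∅ := by
      rw [Finset.eq_empty_iff_forall_notMem]
      intro σ hσ
      rw [mem_layer] at hσ
      have := h.card_le σ hσ.1
      omega
    rw [List.getD_append _ _ _ _ (by simpa using hlt), h1,
      List.getD_eq_getElem _ _ (by simpa using hlt), List.getElem_replicate]
    exact Samples.zero c
  · rw [List.getD_append_right _ _ _ _ (by simpa using hlt), List.length_replicate]
    have h1 : layer S D i = layer S p.order (i - (D - p.order)) := by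
      ext σ
      rw [mem_layer, mem_layer]
      have : σ.support.card + i = D ↔ σ.support.card + (i - (D - p.order)) = p.order := by omega
      rw [this]
    rw [h1]
    exact h.coeff _ (by omega)

lemma RepPoly.weaken (h : RepPoly K p S W c) (hcd : c ≤ d) : RepPoly K p S W d :=
  { h with coeff := fun i hi => (h.coeff i hi).mono hcd }

lemma RepPoly.add (hK : 1 ≤ K) (hp : RepPoly K p S W c) (hq : RepPoly K q T W c)
    (hd : Disjoint S T) :
    RepPoly K (TruncPoly.add K p q).val (S ∪ T) W (c + (3 * Fintype.card V + 4)) := by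
  unfold TruncPoly.add
  split_ifs with h1 h2
  · rw [List.isEmpty_iff, hp.coeffs_eq_nil_iff] at h1
    rw [h1, Finset.empty_union]
    exact hq.weaken (Nat.le_add_right _ _)
  · rw [List.isEmpty_iff, hq.coeffs_eq_nil_iff] at h2
    rw [h2, Finset.union_empty]
    exact hp.weaken (Nat.le_add_right _ _)
  · rw [List.isEmpty_iff] at h1 h2
    have hS : S.Nonempty := Finset.nonempty_iff_ne_empty.mpr fun h => h1 (hp.coeffs_eq_nil_iff.mpr h)
    have hT : T.Nonempty := Finset.nonempty_iff_ne_empty.mpr fun h => h2 (hq.coeffs_eq_nil_iff.mpr h)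
    have hlp := List.length_pos_iff.mpr h1
    have hlp' := hp.length_le_order
    have hlq' := hq.length_le_order
    simp only [Timed.bind, Timed.ret]
    refine ⟨?_, ?_, ?_, ?_, ?_, ?_, ?_⟩
    · intro σ hσ
      rcases Finset.mem_union.mp hσ with h | h
      · exact hp.support_subset σ h
      · exact hq.support_subset σ h
    · refine iff_of_false (List.length_pos_iff.mp ?_) (hS.mono Finset.subset_union_left).ne_empty
      rw [addCoeffs_length, List.length_take, List.length_append]
      omega
    · rw [addCoeffs_length, List.length_take, List.length_take]
      omega
    · simp only [addCoeffs_length, List.length_take, List.length_append, List.length_replicate]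
      omega
    · intro σ hσ
      rcases Finset.mem_union.mp hσ with h | h
      · exact (hp.card_le σ h).trans (le_max_left _ _)
      · exact (hq.card_le σ h).trans (le_max_right _ _)
    · intro _
      rcases le_total p.order q.order with h | h
      · obtain ⟨σ, hσ, he⟩ := hq.exists_card hT
        exact ⟨σ, Finset.mem_union_right _ hσ, by rw [he, max_eq_right h]⟩
      · obtain ⟨σ, hσ, he⟩ := hp.exists_card hS
        exact ⟨σ, Finset.mem_union_left _ hσ, by rw [he, max_eq_left h]⟩
    · intro i hi
      rw [layer_union]
      -- In truncated subtraction at most one of the two paddings is nonzero, and both align the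
      -- lists at the larger order.
      have e1 : q.order - p.order = max p.order q.order - p.order := by omega
      have e2 : p.order - q.order = max p.order q.order - q.order := by omega
      rw [e1, e2]
      exact Samples.addCoeffs (hd.mono (layer_subset _ _ _) (layer_subset _ _ _)) _ _ i
        (hp.coeff_align (le_max_left _ _) hi) (hq.coeff_align (le_max_right _ _) hi)

lemma runList_val {α : Type*} (xs : List (Timed α)) :
    (TruncPoly.runList xs).val = xs.map Timed.val := by
  induction xs with
  | nil => rfl
  | cons x xs ih => simp [TruncPoly.runList, Timed.bind, Timed.ret, ih]

lemma runList_elemOps {α : Type*} (xs : List (Timed α)) :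
    (TruncPoly.runList xs).elemOps = (xs.map Timed.elemOps).sum := by
  induction xs with
  | nil => rfl
  | cons x xs ih => simp [TruncPoly.runList, Timed.bind, Timed.ret, ih]

lemma runList_treeOps {α : Type*} (xs : List (Timed α)) :
    (TruncPoly.runList xs).treeOps = (xs.map Timed.treeOps).sum := by
  induction xs with
  | nil => rfl
  | cons x xs ih => simp [TruncPoly.runList, Timed.bind, Timed.ret, ih]

/-- The indices of the products in the coefficient with index `j` of a product. -/
def convIndices (m n j : ℕ) : List ℕ :=
  (List.range (j + 1)).filter fun i => i < m ∧ j - i < n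

lemma mem_convIndices {m n j i : ℕ} :
    i ∈ convIndices m n j ↔ i ≤ j ∧ i < m ∧ j - i < n := by
  simp [convIndices]

lemma convIndices_nodup (m n j : ℕ) : (convIndices m n j).Nodup :=
  List.nodup_range.filter _

lemma convIndices_length_le_left (m n j : ℕ) : (convIndices m n j).length ≤ m := by
  rw [← List.toFinset_card_of_nodup (convIndices_nodup m n j)]
  conv_rhs => rw [← Finset.card_range m]
  refine Finset.card_le_card fun i hi => ?_
  rw [List.mem_toFinset, mem_convIndices] at hi
  exact Finset.mem_range.mpr hi.2.1

lemma convIndices_length_le_right (m n j : ℕ) : (convIndices m n j).length ≤ n := by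
  rw [← List.toFinset_card_of_nodup (convIndices_nodup m n j)]
  conv_rhs => rw [← Finset.card_range n]
  refine Finset.card_le_card_of_injOn (fun i => j - i) (fun i hi => ?_) fun i hi i' hi' h => ?_
  · rw [Finset.mem_coe, List.mem_toFinset, mem_convIndices] at hi
    simpa using hi.2.2
  · rw [Finset.mem_coe, List.mem_toFinset, mem_convIndices] at hi hi'
    simp only at h
    omega

lemma convIndices_length_le (m n j : ℕ) : (convIndices m n j).length ≤ j + 1 :=
  (List.length_filter_le _ _).trans (by simp)

lemma filterMap_eq_map_filter {α β : Type*} (l : List α) (g : α → Option β) (P : α → Prop)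
    [DecidablePred P] (f : α → β) (h : ∀ a, g a = if P a then some (f a) else none) :
    l.filterMap g = (l.filter fun a => P a).map f := by
  induction l with
  | nil => rfl
  | cons a l ih =>
    rw [List.filterMap_cons, h]
    by_cases hP : P a <;> simp [hP, ih]

lemma convCoeff_eq (as bs : List (ExprTree V)) (j : ℕ) :
    TruncPoly.convCoeff as bs j =
      (TruncPoly.runList ((convIndices as.length bs.length j).map fun i =>
        ExprTree.mkProd (as.getD i .zero) (bs.getD (j - i) .zero))).bind ExprTree.sumList := by
  rw [TruncPoly.convCoeff, convIndices,
    ← filterMap_eq_map_filter (P := fun i => i < as.length ∧ j - i < bs.length)]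
  intro i
  by_cases h1 : i < as.length <;> by_cases h2 : j - i < bs.length <;>
    simp [h1, h2]

lemma convCoeff_ops (as bs : List (ExprTree V)) (j : ℕ) :
    (TruncPoly.convCoeff as bs j).elemOps = 0 ∧
      (TruncPoly.convCoeff as bs j).treeOps ≤ 2 * j + 1 := by
  rw [convCoeff_eq]
  simp only [Timed.bind, sumList_elemOps, runList_elemOps, runList_treeOps, runList_val,
    List.map_map]
  have h := sumList_treeOps_le (List.map (Timed.val ∘ fun i =>
        ExprTree.mkProd (as.getD i .zero) (bs.getD (j - i) .zero))
      (convIndices as.length bs.length j))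
  have hl := convIndices_length_le as.length bs.length j
  rw [List.length_map] at h
  have h1 : (List.map (Timed.treeOps ∘ fun i =>
      ExprTree.mkProd (as.getD i .zero) (bs.getD (j - i) .zero))
      (convIndices as.length bs.length j)).sum = (convIndices as.length bs.length j).length := by
    simp [Function.comp_def, ExprTree.mkProd, Timed.tickTree, Timed.ret]
  refine ⟨by simp [Function.comp_def, ExprTree.mkProd, Timed.tickTree, Timed.ret], ?_⟩
  rw [h1]
  omega

lemma add_elemOps (K : ℕ) (p q : TruncPoly V) : (TruncPoly.add K p q).elemOps = 0 := by
  unfold TruncPoly.add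
  split_ifs <;> simp [Timed.bind, Timed.ret, addCoeffs_ops]

lemma add_treeOps_le (K : ℕ) (p q : TruncPoly V) : (TruncPoly.add K p q).treeOps ≤ K ^ 2 := by
  unfold TruncPoly.add
  split_ifs
  · simp [Timed.ret]
  · simp [Timed.ret]
  · simp only [Timed.bind, Timed.ret, add_zero]
    refine (addCoeffs_ops _ _).2.trans ?_
    rw [List.length_take]
    exact (min_le_left _ _).trans (Nat.le_self_pow (by norm_num) K)

lemma mul_elemOps (K : ℕ) (p q : TruncPoly V) : (TruncPoly.mul K p q).elemOps = 0 := by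
  unfold TruncPoly.mul
  split_ifs
  · rfl
  · simp [Timed.bind, Timed.ret, runList_elemOps, Function.comp_def, convCoeff_ops]

lemma mul_treeOps_le (K : ℕ) (p q : TruncPoly V) : (TruncPoly.mul K p q).treeOps ≤ K ^ 2 := by
  unfold TruncPoly.mul
  split_ifs
  · simp [Timed.ret]
  · simp only [Timed.bind, Timed.ret, add_zero, runList_treeOps, List.map_map]
    -- The coefficient with index `j` needs at most `j + 1` products and `j` sums, and the odd
    -- numbers `2 * j + 1` for `j < m` add up to `m ^ 2`.
    have key : ∀ m, (List.map (Timed.treeOps ∘ TruncPoly.convCoeff p.coeffs q.coeffs)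
        (List.range m)).sum ≤ m ^ 2 := by
      intro m
      induction m with
      | zero => simp
      | succ m ih =>
        rw [List.range_succ, List.map_append, List.sum_append]
        have := (convCoeff_ops p.coeffs q.coeffs m).2
        simp only [List.map_singleton, List.sum_singleton, Function.comp_apply]
        nlinarith
    exact (key _).trans (Nat.pow_le_pow_left (min_le_left _ _) 2)

variable [DecidableEq V]

lemma card_support_bitOr (hXY : Disjoint X Y) (hS : ∀ σ ∈ S, σ.support ⊆ X)
    (hT : ∀ σ ∈ T, σ.support ⊆ Y) {σ τ : BitString V} (hσ : σ ∈ S) (hτ : τ ∈ T) :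
    (bitOr σ τ).support.card = σ.support.card + τ.support.card := by
  rw [support_bitOr, Finset.card_union_of_disjoint (hXY.mono (hS σ hσ) (hT τ hτ))]

/-- Sizes add over disjoint supports, so a deficit `j` from the top order splits into deficits `i`
and `j - i`. Both are at most `j < K`, hence both layers have been kept. -/
lemma RepPoly.exists_index (hp : RepPoly K p S X c) (hq : RepPoly K q T Y d)
    (hXY : Disjoint X Y) {j : ℕ} (hj : j < K) {τ : BitString V}
    (hτ : τ ∈ layer (Finset.image₂ bitOr S T) (p.order + q.order) j) :
    ∃ i ∈ convIndices p.coeffs.length q.coeffs.length j,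
      τ ∈ Finset.image₂ bitOr (layer S p.order i) (layer T q.order (j - i)) := by
  rw [mem_layer, Finset.mem_image₂] at hτ
  obtain ⟨⟨x, hx, y, hy, rfl⟩, hc⟩ := hτ
  rw [card_support_bitOr hXY hp.support_subset hq.support_subset hx hy] at hc
  have h1 := hp.card_le x hx
  have h2 := hq.card_le y hy
  have hx' : x ∈ layer S p.order (p.order - x.support.card) := mem_layer.mpr ⟨hx, by omega⟩
  have hy' : y ∈ layer T q.order (j - (p.order - x.support.card)) := mem_layer.mpr ⟨hy, by omega⟩
  exact ⟨p.order - x.support.card, mem_convIndices.mpr ⟨by omega, hp.lt_length (by omega) ⟨x, hx'⟩,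
    hq.lt_length (by omega) ⟨y, hy'⟩⟩, Finset.mem_image₂_of_mem hx' hy'⟩

/-- The products for different `i` are disjoint because the left factor, and with it its size, can
be recovered from the string. At most `min |X| |Y| + 1` products are joined and all sizes are at
most `2 ^ (|X| + |Y|)`, so the join costs at most `min |X| |Y| * (3 * (|X| + |Y|) + 4) ≤ 10 |X|
|Y|`. -/
lemma RepPoly.convCoeff (hp : RepPoly K p S X c) (hq : RepPoly K q T Y d)
    (hXY : Disjoint X Y) {j : ℕ} (hj : j < K) :
    Samples (TruncPoly.convCoeff p.coeffs q.coeffs j).val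
      (layer (Finset.image₂ bitOr S T) (p.order + q.order) j)
      (c + d + (Fintype.card V + 1) + 10 * (X.card * Y.card)) := by
  set l := convIndices p.coeffs.length q.coeffs.length j with hl
  have hinj : ∀ x ∈ S, ∀ y ∈ T, ∀ x' ∈ S, ∀ y' ∈ T, bitOr x y = bitOr x' y' → x = x' ∧ y = y' :=
    fun x hx y hy x' hx' y' hy' h => bitOr_inj hXY (hp.support_subset x hx)
      (hq.support_subset y hy) (hp.support_subset x' hx') (hq.support_subset y' hy') h
  have hset : l.toFinset.biUnion
      (fun i => Finset.image₂ bitOr (layer S p.order i) (layer T q.order (j - i))) =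
      layer (Finset.image₂ bitOr S T) (p.order + q.order) j := by
    ext τ
    rw [Finset.mem_biUnion]
    constructor
    · rintro ⟨i, hi, hτ⟩
      rw [List.mem_toFinset, mem_convIndices] at hi
      obtain ⟨x, hx, y, hy, rfl⟩ := Finset.mem_image₂.mp hτ
      rw [mem_layer] at hx hy
      refine mem_layer.mpr ⟨Finset.mem_image₂_of_mem hx.1 hy.1, ?_⟩
      rw [card_support_bitOr hXY hp.support_subset hq.support_subset hx.1 hy.1]
      omega
    · intro hτ
      obtain ⟨i, hi, h⟩ := hp.exists_index hq hXY hj hτ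
      exact ⟨i, List.mem_toFinset.mpr hi, h⟩
  -- The depth bound `min |X| |Y|` is crude, from `k + 1 ≤ 2 ^ k`, but it vanishes when either
  -- vertex set is empty, as the bound `10 |X| |Y|` requires.
  have hlen : l.length ≤ 2 ^ min X.card Y.card := by
    have h1 := (convIndices_length_le_left p.coeffs.length q.coeffs.length j).trans
      hp.length_le_card
    have h2 := (convIndices_length_le_right p.coeffs.length q.coeffs.length j).trans
      hq.length_le_card
    rw [← hl] at h1 h2
    have h3 : min X.card Y.card < 2 ^ min X.card Y.card := Nat.lt_two_pow_self
    omega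
  have key := Samples.sumList (c := c + d + (Fintype.card V + 1)) (n := X.card + Y.card)
    (fun i => (ExprTree.mkProd (p.coeffs.getD i .zero) (q.coeffs.getD (j - i) .zero)).val)
    (fun i => Finset.image₂ bitOr (layer S p.order i) (layer T q.order (j - i)))
    (min X.card Y.card) l hlen (convIndices_nodup _ _ _)
    (fun i hi => by
      have hi' := mem_convIndices.mp hi
      exact (hp.coeff i (by omega)).mkProd (hq.coeff (j - i) (by omega))
        fun x hx y hy x' hx' y' hy' h => hinj x (layer_subset _ _ _ hx) y (layer_subset _ _ _ hy)
          x' (layer_subset _ _ _ hx') y' (layer_subset _ _ _ hy') h)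
    (fun i _ i' _ hne => by
      rw [Finset.disjoint_left]
      intro τ h1 h2
      obtain ⟨x, hx, y, hy, rfl⟩ := Finset.mem_image₂.mp h1
      obtain ⟨x', hx', y', hy', h⟩ := Finset.mem_image₂.mp h2
      rw [mem_layer] at hx hy hx' hy'
      obtain ⟨rfl, -⟩ := hinj x' hx'.1 y' hy'.1 x hx.1 y hy.1 h
      omega)
    (by
      rw [hset, ← Finset.card_union_of_disjoint hXY]
      exact card_le_two_pow_of_support_subset fun σ hσ =>
        support_subset_of_mem_image₂ hp.support_subset hq.support_subset σ (layer_subset _ _ _ hσ))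
  rw [hset] at key
  rw [convCoeff_eq]
  simp only [Timed.bind, runList_val, List.map_map]
  refine key.mono (Nat.add_le_add_left ?_ _)
  have h1 := Nat.mul_le_mul_right Y.card (min_le_left X.card Y.card)
  have h2 := Nat.mul_le_mul_left X.card (min_le_right X.card Y.card)
  have h3 : min X.card Y.card ≤ X.card * Y.card := by
    rcases Nat.eq_zero_or_pos Y.card with h | h
    · simp [h]
    · exact (min_le_left _ _).trans (Nat.le_mul_of_pos_right _ h)
  nlinarith

lemma RepPoly.mul (hK : 1 ≤ K) (hp : RepPoly K p S X c) (hq : RepPoly K q T Y d)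
    (hXY : Disjoint X Y) :
    RepPoly K (TruncPoly.mul K p q).val (Finset.image₂ bitOr S T) (X ∪ Y)
      (c + d + (Fintype.card V + 1) + 10 * (X.card * Y.card)) := by
  unfold TruncPoly.mul
  split_ifs with h
  · rw [Bool.or_eq_true, List.isEmpty_iff, List.isEmpty_iff, hp.coeffs_eq_nil_iff,
      hq.coeffs_eq_nil_iff] at h
    rw [Finset.image₂_eq_empty_iff.mpr h]
    exact RepPoly.of_empty _ _
  · rw [Bool.or_eq_true, List.isEmpty_iff, List.isEmpty_iff, not_or] at h
    have hS : S.Nonempty :=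
      Finset.nonempty_iff_ne_empty.mpr fun h' => h.1 (hp.coeffs_eq_nil_iff.mpr h')
    have hT : T.Nonempty :=
      Finset.nonempty_iff_ne_empty.mpr fun h' => h.2 (hq.coeffs_eq_nil_iff.mpr h')
    have hlp := List.length_pos_iff.mpr h.1
    have hlq := List.length_pos_iff.mpr h.2
    have hlp' := hp.length_le_order
    have hlq' := hq.length_le_order
    simp only [Timed.bind, Timed.ret, runList_val, List.map_map]
    set m := min K (p.coeffs.length + q.coeffs.length - 1) with hm
    refine ⟨support_subset_of_mem_image₂ hp.support_subset hq.support_subset, ?_, ?_, ?_, ?_, ?_,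
      ?_⟩
    · refine iff_of_false (List.length_pos_iff.mp ?_) (hS.image₂ hT).ne_empty
      rw [List.length_map, List.length_range]
      omega
    · rw [List.length_map, List.length_range]
      omega
    · rw [List.length_map, List.length_range]
      simp only
      omega
    · intro τ hτ
      obtain ⟨x, hx, y, hy, rfl⟩ := Finset.mem_image₂.mp hτ
      rw [card_support_bitOr hXY hp.support_subset hq.support_subset hx hy]
      exact Nat.add_le_add (hp.card_le x hx) (hq.card_le y hy)
    · intro _
      obtain ⟨x, hx, hxc⟩ := hp.exists_card hS
      obtain ⟨y, hy, hyc⟩ := hq.exists_card hT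
      exact ⟨_, Finset.mem_image₂_of_mem hx hy, by
        rw [card_support_bitOr hXY hp.support_subset hq.support_subset hx hy, hxc, hyc]⟩
    · intro j hj
      by_cases hjm : j < m
      · rw [List.getD_eq_getElem _ _ (by simpa using hjm), List.getElem_map, List.getElem_range]
        exact hp.convCoeff hq hXY hj
      · rw [List.getD_eq_default _ _ (by simpa using hjm)]
        -- An index `j < K` beyond the computed range is at least the sum of the two lengths minus
        -- one, so no pair of stored coefficients contributes to it.
        have : layer (Finset.image₂ bitOr S T) (p.order + q.order) j = ∅ := by
          rw [Finset.eq_empty_iff_forall_notMem]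
          intro τ hτ
          obtain ⟨i, hi, -⟩ := hp.exists_index hq hXY hj hτ
          rw [mem_convIndices] at hi
          omega
        rw [this]
        exact Samples.zero _

lemma isSemantics_repPoly (hK : 1 ≤ K) :
    IsSemantics (TruncPoly.elements V K) (RepPoly (V := V) K) where
  zero W := RepPoly.of_empty W _
  one W := by
    have h : (zeroBits V).support ⊆ W := by simp [support_zeroBits]
    have := RepPoly.of_singleton hK h
    rwa [support_zeroBits] at this
  add h₁ h₂ hd := h₁.add hK h₂ hd
  mul h₁ h₂ hd := h₁.mul hK h₂ hd

lemma repPoly_unitBits (hK : 1 ≤ K) (v : V) :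
    RepPoly K ⟨1, [.leaf (unitBits v)]⟩ {unitBits v} {v} (Fintype.card V + 1) := by
  have := RepPoly.of_singleton hK (support_unitBits v).subset
  rwa [support_unitBits] at this

/-- The stored layers that are nonempty are those of size larger than the order minus `K`. There are
at most `|V| + 1` of them to join, so depth `|V|` suffices. -/
lemma RepPoly.sumList (h : RepPoly K p S W c) :
    Samples (ExprTree.sumList p.coeffs).val
      (S.filter fun σ => p.order < σ.support.card + K)
      (c + Fintype.card V * (3 * Fintype.card V + 4)) := by
  have hmap : p.coeffs = (List.range p.coeffs.length).map fun i => p.coeffs.getD i .zero := by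
    refine List.ext_getElem (by simp) fun i h1 h2 => ?_
    rw [List.getElem_map, List.getElem_range, List.getD_eq_getElem _ _ h1]
  have hset : (List.range p.coeffs.length).toFinset.biUnion (layer S p.order) =
      S.filter fun σ => p.order < σ.support.card + K := by
    ext σ
    simp only [Finset.mem_biUnion, List.mem_toFinset, List.mem_range, Finset.mem_filter, mem_layer]
    constructor
    · rintro ⟨i, hi, hσ, hc⟩
      have := h.length_le
      exact ⟨hσ, by omega⟩
    · rintro ⟨hσ, hc⟩
      have h1 := h.card_le σ hσ
      have h2 : σ.support.card + (p.order - σ.support.card) = p.order := by omega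
      exact ⟨_, h.lt_length (by omega) ⟨σ, mem_layer.mpr ⟨hσ, h2⟩⟩, hσ, h2⟩
  have hlen : p.coeffs.length ≤ 2 ^ Fintype.card V := by
    have h1 := h.length_le_card
    have h2 := Finset.card_le_univ W
    have h3 : Fintype.card V < 2 ^ Fintype.card V := Nat.lt_two_pow_self
    omega
  have key := Samples.sumList (c := c) (n := Fintype.card V) (fun i => p.coeffs.getD i .zero)
    (layer S p.order) (Fintype.card V) (List.range p.coeffs.length) (by simpa using hlen)
    List.nodup_range
    (fun i hi => h.coeff i ((List.mem_range.mp hi).trans_le h.length_le))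
    (fun i _ i' _ hne => by
      rw [Finset.disjoint_left]
      intro σ h1 h2
      rw [mem_layer] at h1 h2
      omega)
    (card_le_two_pow_card _)
  rwa [hset, ← hmap] at key

end Layer

end SumProductSampling
-- Independent sets and the assembly of the bounds.
namespace SumProductSampling

variable {V : Type*} [Fintype V] [LinearOrder V] (G : SimpleGraph V) [DecidableRel G.Adj]

lemma mem_indepStrings {σ : BitString V} :
    σ ∈ indepStrings G ↔ G.IsIndepSet (σ.support : Set V) := by
  simp [indepStrings]

lemma zeroBits_mem_indepStrings : zeroBits V ∈ indepStrings G := by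
  simp [mem_indepStrings, support_zeroBits, SimpleGraph.IsIndepSet]

lemma card_support_le_indepNum {σ : BitString V} (hσ : σ ∈ indepStrings G) :
    σ.support.card ≤ G.indepNum :=
  ((mem_indepStrings G).mp hσ).card_le_indepNum

lemma exists_mem_indepStrings_card_eq :
    ∃ σ ∈ indepStrings G, σ.support.card = G.indepNum := by
  obtain ⟨s, hs⟩ := G.exists_isNIndepSet_indepNum
  exact ⟨bits s, by rw [mem_indepStrings, support_bits]; exact hs.isIndepSet,
    by rw [support_bits]; exact hs.card_eq⟩

lemma filter_indepStrings (K : ℕ) :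
    ((indepStrings G).filter fun σ => G.indepNum < σ.support.card + K) =
      largeIndepStrings G K := by
  ext σ
  simp [indepStrings, largeIndepStrings]

lemma largeIndepStrings_nonempty {K : ℕ} (hK : 1 ≤ K) : (largeIndepStrings G K).Nonempty := by
  obtain ⟨σ, hσ, hc⟩ := exists_mem_indepStrings_card_eq G
  rw [← filter_indepStrings]
  exact ⟨σ, Finset.mem_filter.mpr ⟨hσ, by omega⟩⟩

variable {G}

lemma card_le_two_mul_card_edgeFinset (h : ∀ v, ∃ w, G.Adj v w) :
    Fintype.card V ≤ 2 * G.edgeFinset.card := by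
  rw [← G.sum_degrees_eq_twice_card_edges, ← Finset.card_univ, Finset.card_eq_sum_ones]
  refine Finset.sum_le_sum fun v _ => ?_
  obtain ⟨w, hw⟩ := h v
  exact (G.degree_pos_iff_exists_adj v).mpr ⟨w, hw⟩

lemma cost_le_of_samples {b : Timed (ExprTree V)} {S : Finset (BitString V)} {n c M : ℕ}
    (h : Samples b.val S c) (hS : S.Nonempty) (hb : b.elemOps = n)
    (hc : c ≤ 23 * (Fintype.card V * (Fintype.card V + G.edgeFinset.card))) :
    ∀ r ∈ (buildAndSample b M).support,
      r.2 ≤ n + 69 * (Fintype.card V * (Fintype.card V + G.edgeFinset.card) * M) ∧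
      ((∀ v, ∃ w, G.Adj v w) →
        r.2 ≤ n + 69 * (Fintype.card V * G.edgeFinset.card * M)) := by
  intro r hr
  have h1 := h.buildAndSample_cost_le hS M r hr
  rw [hb] at h1
  have h2 := Nat.mul_le_mul_right M hc
  refine ⟨by nlinarith, fun hadj => ?_⟩
  -- Without isolated vertices `|V| ≤ 2 |E|`, hence `|V| + |E| ≤ 3 |E|`; this turns the constant
  -- `23` into `69`.
  have h3 : Fintype.card V * (Fintype.card V + G.edgeFinset.card) ≤
      3 * (Fintype.card V * G.edgeFinset.card) := by
    have := Nat.mul_le_mul_left (Fintype.card V) (card_le_two_mul_card_edgeFinset hadj)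
    linarith
  have h4 := Nat.mul_le_mul_right M h3
  linarith

lemma samples_buildAll {T : ContractionTree (V ⊕ G.edgeSet)} (hT : T.IsOrder) :
    Samples (buildAll G T).val (indepStrings G) (costBound G T) :=
  (rep_contractScalar isSemantics_repTree (fun v => ⟨Samples.leaf (unitBits v), by
    simp [support_unitBits]⟩) hT).1

lemma repPoly_contractScalar {K : ℕ} (hK : 1 ≤ K) {T : ContractionTree (V ⊕ G.edgeSet)}
    (hT : T.IsOrder) :
    RepPoly K (contractScalar (TruncPoly.elements V K)
      (misNetwork G (TruncPoly.elements V K) fun v => ⟨1, [.leaf (unitBits v)]⟩) T).val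
      (indepStrings G) (vertexLeaves G T) (costBound G T) :=
  rep_contractScalar (isSemantics_repPoly hK) (repPoly_unitBits hK) hT

lemma samples_buildLarge {K : ℕ} (hK : 1 ≤ K) {T : ContractionTree (V ⊕ G.edgeSet)}
    (hT : T.IsOrder) :
    Samples (buildLarge G K T).val (largeIndepStrings G K)
      (costBound G T + Fintype.card V * (3 * Fintype.card V + 4)) := by
  have h := repPoly_contractScalar hK hT
  have key := h.sumList
  obtain ⟨σ, hσ, hc⟩ := h.exists_card ⟨_, zeroBits_mem_indepStrings G⟩
  obtain ⟨τ, hτ, hc'⟩ := exists_mem_indepStrings_card_eq G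
  -- The order of the result is attained by an independent set and bounds the size of all of them,
  -- so it equals `α(G)`.
  have horder := le_antisymm (hc' ▸ h.card_le τ hτ) (hc ▸ card_support_le_indepNum G hσ)
  rw [← horder, filter_indepStrings] at key
  exact key

lemma buildAll_elemOps (T : ContractionTree (V ⊕ G.edgeSet)) :
    (buildAll G T).elemOps = T.opCount (misLabels G) :=
  contract_elemOps (A := ExprTree.elements V) (fun _ _ => rfl) (fun _ _ => rfl) _ T

lemma buildAll_treeOps (T : ContractionTree (V ⊕ G.edgeSet)) :
    (buildAll G T).treeOps = T.opCount (misLabels G) := by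
  rw [← buildAll_elemOps]
  refine le_antisymm ?_ ?_
  · have := contract_treeOps_le (A := ExprTree.elements V) (k := 1) (fun _ _ => le_rfl)
      (fun _ _ => le_rfl) (misNetwork G (ExprTree.elements V) fun v => .leaf (unitBits v)) T
    rwa [one_mul] at this
  · exact contract_elemOps_le_treeOps (A := ExprTree.elements V) (fun _ _ => rfl)
      (fun _ _ => rfl) (fun _ _ => le_rfl) (fun _ _ => le_rfl) _ T

lemma buildLarge_elemOps (K : ℕ) (T : ContractionTree (V ⊕ G.edgeSet)) :
    (buildLarge G K T).elemOps = T.opCount (misLabels G) := by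
  simp only [buildLarge, contractScalar, Timed.bind, Timed.ret, sumList_elemOps, add_zero]
  exact contract_elemOps (A := TruncPoly.elements V K) (add_elemOps K) (mul_elemOps K) _ T

lemma buildLarge_treeOps_le {K : ℕ} (hK : 1 ≤ K) {T : ContractionTree (V ⊕ G.edgeSet)}
    (hT : T.IsOrder) :
    (buildLarge G K T).treeOps ≤ K ^ 2 * T.opCount (misLabels G) + K := by
  have h := (repPoly_contractScalar hK hT).length_le
  have h1 := contract_treeOps_le (A := TruncPoly.elements V K) (add_treeOps_le K)
    (mul_treeOps_le K)
    (misNetwork G (TruncPoly.elements V K) fun v => ⟨1, [.leaf (unitBits v)]⟩) T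
  rw [contract_elemOps (A := TruncPoly.elements V K) (add_elemOps K) (mul_elemOps K)] at h1
  exact Nat.add_le_add h1 ((sumList_treeOps_le _).trans ((Nat.sub_le _ _).trans h))

end SumProductSampling

open SumProductSampling in
theorem mainTheorem10 :
    ∃ C : ℕ, ∀ {V : Type*} [Fintype V] [LinearOrder V] [Nonempty V] (G : SimpleGraph V)
      [DecidableRel G.Adj],
      -- the contraction complexity is attained by a contraction order
      (∃ T : ContractionTree (V ⊕ G.edgeSet),
        T.IsOrder ∧ T.opCount (misLabels G) = misComplexity G) ∧
      ∀ T : ContractionTree (V ⊕ G.edgeSet), T.IsOrder →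
        -- all the independent sets
        ((buildAll G T).val.expand = indepStrings G ∧
          (buildAll G T).elemOps = T.opCount (misLabels G) ∧
          (buildAll G T).treeOps = T.opCount (misLabels G) ∧
          ∀ M : ℕ,
            IsUniformSample (buildAndSample (buildAll G T) M) (indepStrings G) ∧
            ∀ r ∈ (buildAndSample (buildAll G T) M).support,
              r.2 ≤ T.opCount (misLabels G)
                + C * (Fintype.card V * (Fintype.card V + G.edgeFinset.card) * M) ∧
              ((∀ v, ∃ w, G.Adj v w) →
                r.2 ≤ T.opCount (misLabels G)
                  + C * (Fintype.card V * G.edgeFinset.card * M))) ∧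
        -- the independent sets of size larger than `α(G) - K`
        (∀ K : ℕ, 1 ≤ K →
          (buildLarge G K T).val.expand = largeIndepStrings G K ∧
          (buildLarge G K T).elemOps = T.opCount (misLabels G) ∧
          (buildLarge G K T).treeOps ≤ K ^ 2 * T.opCount (misLabels G) + K ∧
          ∀ M : ℕ,
            IsUniformSample (buildAndSample (buildLarge G K T) M) (largeIndepStrings G K) ∧
            ∀ r ∈ (buildAndSample (buildLarge G K T) M).support,
              r.2 ≤ T.opCount (misLabels G)
                + C * (Fintype.card V * (Fintype.card V + G.edgeFinset.card) * M) ∧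
              ((∀ v, ∃ w, G.Adj v w) →
                r.2 ≤ T.opCount (misLabels G)
                  + C * (Fintype.card V * G.edgeFinset.card * M))) := by
  refine ⟨69, fun {V} _ _ _ G _ => ⟨exists_opCount_eq_contractionComplexity _, fun T hT => ?_⟩⟩
  have hcost := costBound_le_of_isOrder (G := G) hT
  refine ⟨?_, fun K hK => ?_⟩
  · have h := samples_buildAll hT
    have hne : (indepStrings G).Nonempty := ⟨_, zeroBits_mem_indepStrings G⟩
    exact ⟨h.expand_eq, buildAll_elemOps T, buildAll_treeOps T, fun M =>
      ⟨h.isUniformSample hne M, cost_le_of_samples h hne (buildAll_elemOps T)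
        ((Nat.le_add_right _ _).trans hcost)⟩⟩
  · have h := samples_buildLarge hK hT
    have hne := largeIndepStrings_nonempty G hK
    exact ⟨h.expand_eq, buildLarge_elemOps K T, buildLarge_treeOps_le hK hT, fun M =>
      ⟨h.isUniformSample hne M, cost_le_of_samples h hne (buildLarge_elemOps K T) hcost⟩⟩
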